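/- Let $S$ be a finite set, $d\in\mathbb N$, $V=\mathbb Z^d\times S$. For every $\sigma\in S$ let $\pi_\sigma:\mathbb Z^d\to[0,\infty)$ be symmetric nearest-neighbour rates ($\pi_\sigma(-x)=\pi_\sigma(x)$, and $\pi_\sigma(x)=0$ unless $x=\pm e_i$ for some $i$), and let $c:S\times S\to[0,\infty)$ be symmetric. For $s\in\{-1,0,1\}$, rates $p(v,w)$ and a constant $\alpha$, let $$\mathscr L_s f(\eta)=\sum_{v,w\in V}p(v,w)\,\eta_v(\alpha+s\eta_w)\big(f(\eta^{v\to w})-f(\eta)\big),$$ where $\eta^{v\to w}$ is $\eta$ with one particle moved from $v$ to $w$. A process generated by $\mathscr L_s$ on $\Omega_s\subseteq\mathbb N^V$, started from $\eta\in\Omega_s$, is a càdlàg (for the product topology) $\Omega_s$-valued process $\{\eta(t):t\ge0\}$ with $\eta(0)=\eta$ almost surely, such that $f(\eta(t))-f(\eta(0))-\int_0^t\mathscr L_sf(\eta(r))\,dr$ is a martingale for every bounded function $f$ of finitely many coordinates, and such that $\sup_{t\le T}\mathbb E[\eta_v(t)^n]<\infty$ for all $T\ge0$, $v\in V$, $n\in\mathbb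 N$. A process with state space $\Omega$ is called dual to a process with state space $\widehat\Omega$, with duality function $D$, if for every $\eta\in\Omega$, every $\xi\in\widehat\Omega$ with $|\xi|=\sum_v\xi_v<\infty$, all versions $\eta(t)$ of the first process started from $\eta$ and $\xi(t)$ of the second process started from $\xi$, and every $t\ge0$: almost surely $|\xi(t)|<\infty$, both $D(\xi,\eta(t))$ and $D(\xi(t),\eta)$ are integrable, and $$\mathbb E_\eta[D(\xi,\eta(t))]=\widehat{\mathbb E}_\xi[D(\xi(t),\eta)].$$ Then the following hold. 1. (Multi-layer symmetric exclusion process, $s=-1$.) Let $\alpha\in\mathbb N$, $\Omega_{-1}=\{0,\dots,\alpha\}^V$ and $p((x,\sigma),(y,\sigma'))=\pi_\sigma(y-x)\delta_{\sigma,\sigma'}+c(\sigma,\sigma')\delta_{x,y}$. The process generated by $\mathscr L_{-1}$ is self-dual with duality function $$D_{-1}(\xi,\eta)=\prod_{v\in V}\frac{\eta_v!}{(\eta_v-\xi_v)!}\cdot\frac{(\alpha-\xi_v)!}{\alpha!}\cdot I(\xi_v\le\eta_v).$$ 2. (Multi-layer symmetric inclusion process, $s=1$.) Let $\alpha>0$,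 $\Omega_1=\mathbb N^V$ and $p$ as in 1. The process generated by $\mathscr L_1$ is self-dual with duality function $$D_1(\xi,\eta)=\prod_{v\in V}\frac{\eta_v!}{(\eta_v-\xi_v)!}\cdot\frac{\Gamma(\alpha)}{\Gamma(\alpha+\xi_v)}\cdot I(\xi_v\le\eta_v).$$ 3. (Multi-layer run-and-tumble particles, $s=0$.) Let $\kappa,\lambda\ge0$, $\alpha>0$, $v:S\to\mathbb Z^d$, $\Omega_0=\mathbb N^V$ and $p((x,\sigma),(y,\sigma'))=\kappa\pi_\sigma(y-x)\delta_{\sigma,\sigma'}+\lambda\delta_{\sigma,\sigma'}\delta_{y,x+v(\sigma)}+c(\sigma,\sigma')\delta_{x,y}$. The process generated by $\mathscr L_0$ is dual to the process of the same form with reversed velocities, i.e. with rates $\widehat p((x,\sigma),(y,\sigma'))=\kappa\pi_\sigma(y-x)\delta_{\sigma,\sigma'}+\lambda\delta_{\sigma,\sigma'}\delta_{y,x-v(\sigma)}+c(\sigma,\sigma')\delta_{x,y}$, with duality function $$D_0(\xi,\eta)=\prod_{v\in V}\frac{\eta_v!}{(\eta_v-\xi_v)!}\cdot I(\xi_v\le\eta_v).$$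 -/

import Mathlib

open MeasureTheory ProbabilityTheory Filter Topology
open scoped NNReal ENNReal Nat

universe u u₁ u₂

noncomputable section

/-! ### Configurations and generators -/

/-- Particle configurations on a set of sites `V`: `η v` is the number of particles at `v`. -/
abbrev Config (V : Type*) := V → ℕ

/-- The configuration `ξ` has finitely many particles. -/
def Config.IsFinite {V : Type*} (ξ : Config V) : Prop := {v | ξ v ≠ 0}.Finite

open Classical in
/-- `η^{v → w}`: a single particle is moved from `v` to `w`, if there is one at `v`. -/
def Config.move {V : Type*} (η : Config V) (v w : V) : Config V :=
  if η v = 0 then η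
  else fun u => η u - (if u = v then 1 else 0) + (if u = w then 1 else 0)

/-- Data of a particle system: a particle jumps from `v` to `w` at rate
`rate v w * η v * (α + s * η w)`; `space` is the set of allowed configurations. -/
structure ParticleSystem (V : Type*) where
  rate : V → V → ℝ
  α : ℝ
  s : ℝ
  space : Set (Config V)

/-- The function `f` depends on finitely many coordinates only. -/
def IsCylinder {V : Type*} (f : Config V → ℝ) : Prop :=
  ∃ Λ : Finset V, ∀ η ζ : Config V, (∀ v ∈ Λ, η v = ζ v) → f η = f ζ

/-- The generator
`L f(η) = ∑_{v,w} p(v,w) η_v (α + s η_w) (f(η^{v → w}) - f(η))`.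
For a cylinder function `f` and rates `p` of finite range only finitely many terms are non-zero. -/
def ParticleSystem.generator {V : Type*} (A : ParticleSystem V) (f : Config V → ℝ)
    (η : Config V) : ℝ :=
  ∑ᶠ e : V × V, A.rate e.1 e.2 * (η e.1 : ℝ) * (A.α + A.s * (η e.2 : ℝ)) *
    (f (η.move e.1 e.2) - f η)

/-- `X` is a process generated by the generator of `A`, started from `η`: a càdlàg process with
values in `A.space` that solves the martingale problem for the generator on bounded
cylinder functions, and whose occupation numbers have moments that are bounded on bounded time
intervals (for exclusion the latter is automatic). -/
structure ParticleSystem.IsProcessFrom {V : Type*} (A : ParticleSystem V) (η : Config V)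
    {Ω : Type*} [MeasurableSpace Ω] (P : Measure Ω) (ℱ : Filtration ℝ≥0 ‹MeasurableSpace Ω›)
    (X : ℝ≥0 → Ω → Config V) : Prop where
  isProbabilityMeasure : IsProbabilityMeasure P
  adapted : ∀ t, Measurable[ℱ t] (X t)
  mem_space : ∀ t ω, X t ω ∈ A.space
  rightContinuous : ∀ ω v t, ContinuousWithinAt (fun r => X r ω v) (Set.Ici t) t
  leftLimits : ∀ ω v t, ∃ l : ℕ, Tendsto (fun r => X r ω v) (𝓝[<] t) (𝓝 l)
  start : ∀ᵐ ω ∂P, X 0 ω = η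
  moments : ∀ (T : ℝ≥0) (v : V) (n : ℕ), ∃ C : ℝ≥0, ∀ t ≤ T,
    ∫⁻ ω, (X t ω v : ℝ≥0∞) ^ n ∂P ≤ C
  martingale : ∀ f : Config V → ℝ, IsCylinder f → (∃ C, ∀ ζ, |f ζ| ≤ C) →
    Martingale (fun (t : ℝ≥0) ω =>
      f (X t ω) - f (X 0 ω) - ∫ r in (0 : ℝ)..t, A.generator f (X r.toNNReal ω)) ℱ P

/-- Duality of the process generated by `A` and the process generated by `B`
with respect to `D(ξ, η)`, where the dual process starts from configurations `ξ` with finitely many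
particles: `E_η[D(ξ, η(t))] = Ê_ξ[D(ξ(t), η)]` for all `ξ`, `η` and `t ≥ 0`, where both expectations
exist and the dual process stays in the set of finite configurations almost surely. -/
def IsDual {V : Type u} (A B : ParticleSystem V) (D : Config V → Config V → ℝ) :
    Prop :=
  ∀ η ∈ A.space, ∀ ξ ∈ B.space, ξ.IsFinite →
  ∀ (Ω : Type u₁) [MeasurableSpace Ω] (P : Measure Ω) (ℱ : Filtration ℝ≥0 ‹MeasurableSpace Ω›)
    (X : ℝ≥0 → Ω → Config V), A.IsProcessFrom η P ℱ X →
  ∀ (Ω' : Type u₂) [MeasurableSpace Ω'] (Q : Measure Ω')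
    (𝒢 : Filtration ℝ≥0 ‹MeasurableSpace Ω'›)
    (Y : ℝ≥0 → Ω' → Config V), B.IsProcessFrom ξ Q 𝒢 Y →
  ∀ t : ℝ≥0,
    (∀ᵐ ω ∂Q, (Y t ω).IsFinite) ∧
    Integrable (fun ω => D ξ (X t ω)) P ∧
    Integrable (fun ω => D (Y t ω) η) Q ∧
    ∫ ω, D ξ (X t ω) ∂P = ∫ ω, D (Y t ω) η ∂Q

/-! ### The multi-layer models on `ℤ^d × S` -/

/-- Sites: a position in `ℤ^d` and an internal state (layer) in `S`. -/
abbrev Site (d : ℕ) (S : Type*) := (Fin d → ℤ) × S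

/-- Symmetric nearest-neighbour rates `π σ` on `ℤ^d` for every layer `σ`, and symmetric
rates `c` for the change of layer. -/
structure LayerRates (d : ℕ) (S : Type*) where
  π : S → (Fin d → ℤ) → ℝ
  c : S → S → ℝ
  π_nonneg : ∀ σ x, 0 ≤ π σ x
  π_symm : ∀ σ x, π σ (-x) = π σ x
  π_nearest : ∀ σ x, π σ x ≠ 0 → ∑ i, |x i| = 1
  c_nonneg : ∀ σ σ', 0 ≤ c σ σ'
  c_symm : ∀ σ σ', c σ σ' = c σ' σ

open Classical in
/-- `p((x,σ),(y,σ')) = π_σ(y-x) δ_{σ,σ'} + c(σ,σ') δ_{x,y}`. -/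
def LayerRates.symmetricRate {d : ℕ} {S : Type*} (R : LayerRates d S) (v w : Site d S) : ℝ :=
  (if v.2 = w.2 then R.π v.2 (w.1 - v.1) else 0) + (if v.1 = w.1 then R.c v.2 w.2 else 0)

open Classical in
/-- `p((x,σ),(y,σ')) = κ π_σ(y-x) δ_{σ,σ'} + λ δ_{σ,σ'} δ_{y,x+v(σ)} + c(σ,σ') δ_{x,y}`. -/
def LayerRates.rtpRate {d : ℕ} {S : Type*} (R : LayerRates d S) (κ lam : ℝ)
    (vel : S → Fin d → ℤ) (v w : Site d S) : ℝ :=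
  (if v.2 = w.2 then κ * R.π v.2 (w.1 - v.1) else 0)
    + (if v.2 = w.2 ∧ w.1 = v.1 + vel v.2 then lam else 0)
    + (if v.1 = w.1 then R.c v.2 w.2 else 0)

/-- Multi-layer symmetric exclusion process, with at most `α` particles per site (`s = -1`). -/
def LayerRates.sep {d : ℕ} {S : Type*} (R : LayerRates d S) (α : ℕ) :
    ParticleSystem (Site d S) where
  rate := R.symmetricRate
  α := α
  s := -1
  space := {η | ∀ v, η v ≤ α}

/-- Multi-layer symmetric inclusion process (`s = 1`). -/
def LayerRates.sip {d : ℕ} {S : Type*} (R : LayerRates d S) (α : ℝ) :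
    ParticleSystem (Site d S) where
  rate := R.symmetricRate
  α := α
  s := 1
  space := Set.univ

/-- Independent run-and-tumble particles with velocity function `vel` (`s = 0`). -/
def LayerRates.rtp {d : ℕ} {S : Type*} (R : LayerRates d S) (κ lam : ℝ)
    (vel : S → Fin d → ℤ) (α : ℝ) : ParticleSystem (Site d S) where
  rate := R.rtpRate κ lam vel
  α := α
  s := 0
  space := Set.univ

/-! ### Duality functions -/

/-- `D(ξ, η) = ∏_v d(ξ_v, η_v)`; since `d 0 n = 1` below, only finitely many factors differ from `1`
when `ξ` is finite. -/
def factorized {V : Type*} (d : ℕ → ℕ → ℝ) (ξ η : Config V) : ℝ :=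
  ∏ᶠ v, d (ξ v) (η v)

/-- `n!/(n-k)! · (α-k)!/α! · 1(k ≤ n)`. -/
def dSEP (α : ℕ) (k n : ℕ) : ℝ :=
  if k ≤ n then (n ! : ℝ) / ((n - k)! : ℝ) * (((α - k)! : ℝ) / (α ! : ℝ)) else 0

/-- `n!/(n-k)! · Γ(α)/Γ(α+k) · 1(k ≤ n)`. -/
def dSIP (α : ℝ) (k n : ℕ) : ℝ :=
  if k ≤ n then (n ! : ℝ) / ((n - k)! : ℝ) * (Real.Gamma α / Real.Gamma (α + k)) else 0

/-- `n!/(n-k)! · 1(k ≤ n)`. -/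
def dRTP (k n : ℕ) : ℝ :=
  if k ≤ n then (n ! : ℝ) / ((n - k)! : ℝ) else 0

end

/-! All three duality functions have the form D(ζ,η) = ∏ β(ζ_v) η_v!/(η_v-ζ_v)!, with weights
satisfying γ β(k) = β(k+1)(α + s k). For one bond, the forward generator acting on η and the
reversed generator acting on ζ then differ by two terms: αD(ζ_w - ζ_v), which cancels over all bonds
because total outgoing and incoming rates agree at every site, and s times an antisymmetric term,
which vanishes for s = 0 and cancels when the rates are symmetric. This is `generator_duality`.

Passing from generators to processes uses only the martingale problem, so it applies to every
version. Dynkin's formula, extended to polynomially growing cylinder functions by the moment bounds,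
shows that u(t,ζ) = E_η D(ζ,η(t)) solves ∂ₜu = L_B u on finite configurations. With the particle
number fixed at k, the total jump rate is bounded, so T = Λ + L_B is a nonnegative kernel with
finite rows for large Λ. All derivatives Tⁿ(e^{Λt}u) of e^{Λt}u are therefore nonnegative, and
Bernstein's theorem gives e^{Λt}u(t,ζ) = ∑ tⁿ/n! · TⁿD(·,η)(ζ) (`hasSum_dualMean`). Positivity
replaces any bound on D(·,η), which may be unbounded on a level.

The law of the dual process ξ(t) comes from the same series with the two systems exchanged. For |ζ|
= |ξ|+1 the initial data vanish, so E D(ζ,ξ(t)) = 0 and almost surely |ξ(t)| ≤ |ξ|. For |ζ| = |ξ|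
the function D(ζ,·) is then a multiple of the indicator of ζ, and duality of the powers of the
generators yields e^{Λt}P(ξ(t) = ζ) = ∑ tⁿ/n! · Tⁿ1_ζ(ξ) (`hasSum_law`). Summing against a
nonnegative f by Tonelli gives the series of Tⁿf(ξ) (`tsum_law`): f = 1 shows that no particle is
lost, and f = D(·,η) gives the series already found for the left side. -/

noncomputable section

section

/-! ### Absolutely monotone families -/

/-- One-sided Taylor estimates on `[s, t]` for a family of nonnegative functions, each of which is
the derivative of the preceding one. -/
theorem taylor_bounds_of_nonneg_derivs {g : ℕ → ℝ → ℝ}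
    (hc : ∀ n, ContinuousOn (g n) (Set.Ici 0)) (hpos : ∀ n t, 0 ≤ t → 0 ≤ g n t)
    (hd : ∀ n t, 0 < t → HasDerivAt (g n) (g (n + 1) t) t) {s t : ℝ} (hs : 0 ≤ s) (hst : s ≤ t)
    (n : ℕ) :
    ∑ k ∈ Finset.range n, (t - s) ^ k / k ! * g k s ≤ g 0 t ∧
      g 0 t ≤ ∑ k ∈ Finset.range n, (t - s) ^ k / k ! * g k s + (t - s) ^ n / n ! * g n t := by
  have hpoly : ∀ (n : ℕ) (r : ℝ), HasDerivAt (fun r => (t - r) ^ (n + 1) / ((n + 1)! : ℝ))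
      (-((t - r) ^ n / (n ! : ℝ))) r := by
    intro n r
    have h1 : HasDerivAt (fun r => t - r) (-1) r := by
      simpa using (hasDerivAt_id r).const_sub t
    refine ((h1.pow (n + 1)).div_const _).congr_deriv ?_
    rw [Nat.factorial_succ]
    have : (n ! : ℝ) ≠ 0 := by positivity
    push_cast
    field_simp
  have hmono : ∀ n, MonotoneOn (g n) (Set.Ici 0) := by
    intro n
    refine monotoneOn_of_deriv_nonneg (convex_Ici 0) (hc n) ?_ ?_
    · intro x hx
      rw [interior_Ici] at hx
      exact (hd n x hx).differentiableAt.differentiableWithinAt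
    · intro x hx
      rw [interior_Ici] at hx
      rw [(hd n x hx).deriv]
      exact hpos _ _ (le_of_lt hx)
  have hsub : Set.Icc s t ⊆ Set.Ici 0 := fun x hx => hs.trans hx.1
  have hφc : ∀ n, ContinuousOn (fun r => ∑ k ∈ Finset.range n, (t - r) ^ k / k ! * g k r)
      (Set.Icc s t) := by
    intro n
    refine continuousOn_finsetSum _ fun k _ => ContinuousOn.mul ?_ ((hc k).mono hsub)
    fun_prop
  -- The derivative of the Taylor polynomial with respect to its base point telescopes to its last
  -- term. Its sign makes the polynomial monotone, and at r = t it equals `g 0 t`.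
  have hφd : ∀ n r, 0 < r → HasDerivAt
      (fun r => ∑ k ∈ Finset.range (n + 1), (t - r) ^ k / k ! * g k r)
      ((t - r) ^ n / n ! * g (n + 1) r) r := by
    intro n r hr
    induction n with
    | zero => simpa using hd 0 r hr
    | succ n ih =>
      simp_rw [Finset.sum_range_succ _ (n + 1)]
      refine (ih.add ((hpoly n r).mul (hd (n + 1) r hr))).congr_deriv ?_
      ring
  have hval : ∀ n, ∑ k ∈ Finset.range (n + 1), (t - t) ^ k / k ! * g k t = g 0 t := by
    intro n
    rw [Finset.sum_range_succ']
    simp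
  cases n with
  | zero =>
    simp only [Finset.range_zero, Finset.sum_empty, pow_zero, Nat.factorial_zero, Nat.cast_one,
      div_one, one_mul, zero_add, le_refl, and_true]
    exact hpos 0 t (hs.trans hst)
  | succ n =>
    have hint : ∀ x ∈ interior (Set.Icc s t), 0 < x ∧ x < t := by
      intro x hx
      rw [interior_Icc] at hx
      exact ⟨hs.trans_lt hx.1, hx.2⟩
    constructor
    · have hm : MonotoneOn (fun r => ∑ k ∈ Finset.range (n + 1), (t - r) ^ k / k ! * g k r)
          (Set.Icc s t) := by
        refine monotoneOn_of_deriv_nonneg (convex_Icc s t) (hφc _) ?_ ?_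
        · intro x hx
          exact (hφd n x (hint x hx).1).differentiableAt.differentiableWithinAt
        · intro x hx
          rw [(hφd n x (hint x hx).1).deriv]
          have h1 : 0 ≤ t - x := by linarith [(hint x hx).2]
          exact mul_nonneg (by positivity) (hpos _ _ (hint x hx).1.le)
      have := hm (Set.left_mem_Icc.2 hst) (Set.right_mem_Icc.2 hst) hst
      simpa only [hval] using this
    -- Adding the remainder with `g (n + 1)` frozen at t makes the expression antitone, since `g (n
    -- + 1)` is itself monotone.
    · have hψd : ∀ r, 0 < r → HasDerivAt
          (fun r => ∑ k ∈ Finset.range (n + 1), (t - r) ^ k / k ! * g k r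
            + (t - r) ^ (n + 1) / ((n + 1)! : ℝ) * g (n + 1) t)
          ((t - r) ^ n / n ! * (g (n + 1) r - g (n + 1) t)) r := by
        intro r hr
        refine ((hφd n r hr).add ((hpoly n r).mul_const _)).congr_deriv ?_
        ring
      have hm : AntitoneOn (fun r => ∑ k ∈ Finset.range (n + 1), (t - r) ^ k / k ! * g k r
            + (t - r) ^ (n + 1) / ((n + 1)! : ℝ) * g (n + 1) t) (Set.Icc s t) := by
        refine antitoneOn_of_deriv_nonpos (convex_Icc s t) ((hφc _).add (by fun_prop)) ?_ ?_
        · intro x hx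
          exact (hψd x (hint x hx).1).differentiableAt.differentiableWithinAt
        · intro x hx
          rw [(hψd x (hint x hx).1).deriv]
          have h1 : 0 ≤ t - x := by linarith [(hint x hx).2]
          have h2 := hmono (n + 1) (hint x hx).1.le ((hint x hx).1.le.trans (hint x hx).2.le)
            (hint x hx).2.le
          exact mul_nonpos_of_nonneg_of_nonpos (by positivity) (by linarith)
      have := hm (Set.left_mem_Icc.2 hst) (Set.right_mem_Icc.2 hst) hst
      simp only [hval] at this
      rwa [sub_self, zero_pow (Nat.succ_ne_zero n), zero_div, zero_mul, add_zero] at this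

/-- Bernstein: an absolutely monotone function on `[0, ∞)` is the sum of its Taylor series. -/
theorem hasSum_taylor_of_nonneg_derivs {g : ℕ → ℝ → ℝ}
    (hc : ∀ n, ContinuousOn (g n) (Set.Ici 0)) (hpos : ∀ n t, 0 ≤ t → 0 ≤ g n t)
    (hd : ∀ n t, 0 < t → HasDerivAt (g n) (g (n + 1) t) t) {t : ℝ} (ht : 0 ≤ t) :
    HasSum (fun n => t ^ n / n ! * g n 0) (g 0 t) := by
  have hnn : ∀ n, 0 ≤ t ^ n / n ! * g n 0 := fun n =>
    mul_nonneg (by positivity) (hpos _ _ le_rfl)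
  rw [hasSum_iff_tendsto_nat_of_nonneg hnn]
  -- Expanding from t to 3t, each single Taylor term (2t)ⁿ/n! · g n t is at most `g 0 (3 * t)`. The
  -- increment 2t, twice the one in the remainder, produces the geometric decay.
  have hrem : ∀ n : ℕ, t ^ n / n ! * g n t ≤ g 0 (3 * t) * (1 / 2) ^ n := by
    intro n
    have h := (taylor_bounds_of_nonneg_derivs hc hpos hd ht (by linarith : t ≤ 3 * t) (n + 1)).1
    have h2 : (3 * t - t) ^ n / n ! * g n t ≤ g 0 (3 * t) := by
      refine le_trans ?_ h
      refine Finset.single_le_sum (f := fun k => (3 * t - t) ^ k / (k ! : ℝ) * g k t) ?_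
        (Finset.self_mem_range_succ n)
      intro k _
      have : 0 ≤ 3 * t - t := by linarith
      exact mul_nonneg (by positivity) (hpos _ _ ht)
    have h3 : (3 * t - t) ^ n = 2 ^ n * t ^ n := by rw [← mul_pow]; ring
    rw [h3] at h2
    calc t ^ n / n ! * g n t = (2 ^ n * t ^ n / n ! * g n t) * (1 / 2) ^ n := by
          rw [one_div, inv_pow]; field_simp
      _ ≤ _ := by gcongr
  have hlim : Tendsto (fun n : ℕ => g 0 t - g 0 (3 * t) * (1 / 2) ^ n) atTop (𝓝 (g 0 t)) := by
    have := (tendsto_pow_atTop_nhds_zero_of_lt_one (by norm_num : (0 : ℝ) ≤ 1 / 2)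
      (by norm_num)).const_mul (g 0 (3 * t))
    simpa using this.const_sub (g 0 t)
  refine tendsto_of_tendsto_of_tendsto_of_le_of_le hlim tendsto_const_nhds ?_ ?_
  · intro n
    have h := (taylor_bounds_of_nonneg_derivs hc hpos hd le_rfl ht n).2
    rw [sub_zero] at h
    have := hrem n
    simp only
    linarith
  · intro n
    have h := (taylor_bounds_of_nonneg_derivs hc hpos hd le_rfl ht n).1
    rwa [sub_zero] at h

/-! ### Finite nonnegative kernels -/

/-- On `E`, the operator `T` is given by a nonnegative kernel with finitely many non-zero entries in
each row, and leading from `E` to `E`. The type `J` labels the entries of a row. -/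
def IsKernelOn (J : Type*) {X : Type*} (T : (X → ℝ) → X → ℝ) (E : Set X) : Prop :=
  ∀ x ∈ E, ∃ (I : Finset J) (y : J → X) (a : J → ℝ), (∀ i ∈ I, y i ∈ E) ∧ (∀ i ∈ I, 0 ≤ a i) ∧
    ∀ f, T f x = ∑ i ∈ I, a i * f (y i)

namespace IsKernelOn

variable {J X : Type*} {T : (X → ℝ) → X → ℝ} {E : Set X}

theorem iterate_nonneg (h : IsKernelOn J T E) {f : X → ℝ} (hf : ∀ x ∈ E, 0 ≤ f x) (n : ℕ) :
    ∀ x ∈ E, 0 ≤ T^[n] f x := by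
  induction n with
  | zero => exact hf
  | succ n ih =>
    intro x hx
    obtain ⟨I, y, a, hy, ha, hT⟩ := h x hx
    rw [Function.iterate_succ_apply', hT]
    exact Finset.sum_nonneg fun i hi => mul_nonneg (ha i hi) (ih _ (hy i hi))

theorem iterate_congr (h : IsKernelOn J T E) {f g : X → ℝ} (hfg : ∀ x ∈ E, f x = g x) (n : ℕ) :
    ∀ x ∈ E, T^[n] f x = T^[n] g x := by
  induction n with
  | zero => exact hfg
  | succ n ih =>
    intro x hx
    obtain ⟨I, y, a, hy, ha, hT⟩ := h x hx
    rw [Function.iterate_succ_apply', Function.iterate_succ_apply', hT, hT]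
    exact Finset.sum_congr rfl fun i hi => by rw [ih _ (hy i hi)]

theorem iterate_sum (h : IsKernelOn J T E) {ι : Type*} (s : Finset ι) (c : ι → ℝ)
    (f : ι → X → ℝ) (n : ℕ) :
    ∀ x ∈ E, T^[n] (fun x => ∑ i ∈ s, c i * f i x) x = ∑ i ∈ s, c i * T^[n] (f i) x := by
  induction n with
  | zero => intro x _; rfl
  | succ n ih =>
    intro x hx
    obtain ⟨I, y, a, hy, ha, hT⟩ := h x hx
    simp only [Function.iterate_succ_apply', hT]
    rw [Finset.sum_congr rfl fun i hi => by rw [ih _ (hy i hi)]]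
    simp_rw [Finset.mul_sum]
    rw [Finset.sum_comm]
    exact Finset.sum_congr rfl fun i _ => Finset.sum_congr rfl fun j _ => by ring

theorem iterate_const_mul (h : IsKernelOn J T E) (c : ℝ) (f : X → ℝ) (n : ℕ) {x : X}
    (hx : x ∈ E) : T^[n] (fun x => c * f x) x = c * T^[n] f x := by
  simpa using h.iterate_sum {()} (fun _ => c) (fun _ => f) n x hx

theorem iterate_one (h : IsKernelOn J T E) {Λ : ℝ} (h1 : ∀ x ∈ E, T (fun _ => 1) x = Λ) (n : ℕ) :
    ∀ x ∈ E, T^[n] (fun _ => 1) x = Λ ^ n := by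
  induction n with
  | zero => intro x _; simp
  | succ n ih =>
    intro x hx
    obtain ⟨I, y, a, hy, ha, hT⟩ := h x hx
    have := h1 x hx
    rw [hT] at this
    rw [Function.iterate_succ_apply', hT, Finset.sum_congr rfl fun i hi => by rw [ih _ (hy i hi)],
      pow_succ', ← this, Finset.sum_mul]
    simp

-- Expansion of f in indicator functions. On a possibly infinite `E` it is legitimate because each
-- row of an iterate still has finite support.
open Classical in
theorem hasSum_iterate (h : IsKernelOn J T E) (f : X → ℝ) (n : ℕ) :
    ∀ x ∈ E, HasSum (fun z : E => f z * T^[n] (fun y => if y = z then 1 else 0) x)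
      (T^[n] f x) := by
  induction n with
  | zero =>
    intro x hx
    have := hasSum_single (f := fun z : E => f z * if x = z then 1 else 0) ⟨x, hx⟩ (by
      intro z hz
      have : x ≠ z := fun hxz => hz (Subtype.ext hxz.symm)
      simp [this])
    simpa using this
  | succ n ih =>
    intro x hx
    obtain ⟨I, y, a, hy, ha, hT⟩ := h x hx
    simp only [Function.iterate_succ_apply', hT]
    have := hasSum_sum fun i (hi : i ∈ I) => (ih _ (hy i hi)).mul_left (a i)
    refine this.congr_fun ?_
    intro z
    rw [Finset.mul_sum]
    exact Finset.sum_congr rfl fun i _ => by ring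

theorem continuousOn_iterate (h : IsKernelOn J T E) {F : ℝ → X → ℝ} {s : Set ℝ}
    (hF : ∀ x ∈ E, ContinuousOn (fun t => F t x) s) (n : ℕ) :
    ∀ x ∈ E, ContinuousOn (fun t => T^[n] (F t) x) s := by
  induction n with
  | zero => exact hF
  | succ n ih =>
    intro x hx
    obtain ⟨I, y, a, hy, ha, hT⟩ := h x hx
    simp only [Function.iterate_succ_apply', hT]
    exact continuousOn_finsetSum _ fun i hi => continuousOn_const.mul (ih _ (hy i hi))

theorem hasDerivAt_iterate (h : IsKernelOn J T E) {F : ℝ → X → ℝ} {F' : X → ℝ} {t : ℝ}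
    (hF : ∀ x ∈ E, HasDerivAt (fun t => F t x) (F' x) t) (n : ℕ) :
    ∀ x ∈ E, HasDerivAt (fun t => T^[n] (F t) x) (T^[n] F' x) t := by
  induction n with
  | zero => exact hF
  | succ n ih =>
    intro x hx
    obtain ⟨I, y, a, hy, ha, hT⟩ := h x hx
    simp only [Function.iterate_succ_apply', hT]
    exact HasDerivAt.fun_sum fun i hi => (ih _ (hy i hi)).const_mul (a i)

/-- A nonnegative solution of `∂ₜ u = (T - Λ) u` on `[0, ∞)` is determined by its initial value,
and given by the exponential series. -/
theorem hasSum_of_evolution (h : IsKernelOn J T E) {u : ℝ → X → ℝ} (Λ : ℝ)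
    (hc : ∀ x ∈ E, ContinuousOn (fun t => u t x) (Set.Ici 0))
    (hpos : ∀ t, 0 ≤ t → ∀ x ∈ E, 0 ≤ u t x)
    (hd : ∀ t, 0 < t → ∀ x ∈ E, HasDerivAt (fun t => u t x) (T (u t) x - Λ * u t x) t)
    {t : ℝ} (ht : 0 ≤ t) {x : X} (hx : x ∈ E) :
    HasSum (fun n => t ^ n / n ! * T^[n] (u 0) x) (Real.exp (Λ * t) * u t x) := by
  -- The exponential factor absorbs the term -Λu, so ∂ₜU = TU and the successive derivatives of U
  -- are the nonnegative functions TⁿU.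
  set U : ℝ → X → ℝ := fun t x => Real.exp (Λ * t) * u t x with hU
  have hTU : ∀ t, ∀ x ∈ E, T (U t) x = Real.exp (Λ * t) * T (u t) x := fun t x hx => by
    simpa using h.iterate_const_mul (Real.exp (Λ * t)) (u t) 1 hx
  have key := hasSum_taylor_of_nonneg_derivs (g := fun n t => T^[n] (U t) x)
    (fun n => h.continuousOn_iterate (fun x hx => ContinuousOn.mul (by fun_prop) (hc x hx)) n x hx)
    (fun n t ht => h.iterate_nonneg
      (fun x hx => mul_nonneg (Real.exp_pos _).le (hpos t ht x hx)) n x hx)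
    (fun n t ht => by
      rw [Function.iterate_succ_apply]
      refine h.hasDerivAt_iterate (fun x hx => ?_) n x hx
      have he : HasDerivAt (fun t => Real.exp (Λ * t)) (Real.exp (Λ * t) * Λ) t := by
        simpa using ((hasDerivAt_id t).const_mul Λ).exp
      refine (he.mul (hd t ht x hx)).congr_deriv ?_
      rw [hTU t x hx]
      ring) ht
  have h0 : U 0 = u 0 := by
    ext x
    simp [hU]
  simpa only [h0, Function.iterate_zero, id_eq] using key

end IsKernelOn

end

section

/-! ### Configurations -/

namespace Config

variable {V : Type*}

/-- The sites occupied in a finite configuration. -/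
def IsFinite.sites {ζ : Config V} (h : ζ.IsFinite) : Finset V := Set.Finite.toFinset h

@[simp]
theorem IsFinite.mem_sites {ζ : Config V} (h : ζ.IsFinite) {v : V} : v ∈ h.sites ↔ ζ v ≠ 0 :=
  Set.Finite.mem_toFinset h

/-- The total number of particles of a finite configuration. -/
def total (ζ : Config V) : ℕ := ∑ᶠ v, ζ v

theorem total_eq_sum {ζ : Config V} {F : Finset V} (h : ∀ v, ζ v ≠ 0 → v ∈ F) :
    ζ.total = ∑ v ∈ F, ζ v :=
  finsum_eq_sum_of_support_subset _ fun v hv => h v hv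

theorem move_of_eq_zero {η : Config V} {v w : V} (h : η v = 0) : η.move v w = η := by
  simp [move, h]

theorem move_self (η : Config V) (v : V) : η.move v v = η := by
  by_cases h : η v = 0
  · exact move_of_eq_zero h
  · ext u
    by_cases hu : u = v
    · subst hu; simp [move, h]; omega
    · simp [move, h, hu]

theorem move_source {η : Config V} {v w : V} (h : η v ≠ 0) (hvw : v ≠ w) :
    η.move v w v = η v - 1 := by
  simp [move, h, hvw]

theorem move_target {η : Config V} {v w : V} (h : η v ≠ 0) (hvw : v ≠ w) :
    η.move v w w = η w + 1 := by
  simp [move, h, hvw.symm]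

theorem move_other {η : Config V} {v w u : V} (hv : u ≠ v) (hw : u ≠ w) :
    η.move v w u = η u := by
  unfold move; split_ifs <;> simp_all

theorem move_le (η : Config V) (v w u : V) : η.move v w u ≤ η u + 1 := by
  unfold move
  split_ifs with h
  · omega
  · dsimp only; split_ifs <;> omega

theorem move_eq_zero {η : Config V} {v w u : V} (hu : η u = 0) (hw : u ≠ w) :
    η.move v w u = 0 := by
  unfold move; split_ifs <;> simp_all

theorem total_move {ζ : Config V} (hζ : ζ.IsFinite) (v w : V) :
    (ζ.move v w).IsFinite ∧ (ζ.move v w).total = ζ.total := by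
  classical
  set F : Finset V := insert v (insert w hζ.sites) with hF
  have h1 : ∀ u, ζ u ≠ 0 → u ∈ F := fun u hu => by simp [hF, hu]
  have h2 : ∀ u, ζ.move v w u ≠ 0 → u ∈ F := by
    intro u hu
    by_contra h
    simp only [hF, Finset.mem_insert, IsFinite.mem_sites, not_or, not_not] at h
    exact hu (move_eq_zero h.2.2 h.2.1)
  refine ⟨F.finite_toSet.subset h2, ?_⟩
  by_cases hv : ζ v = 0
  · rw [move_of_eq_zero hv]
  by_cases hvw : v = w
  · rw [hvw, move_self]
  have hwF : w ∈ F.erase v := by simp [hF, Ne.symm hvw]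
  have hvF : v ∈ F := by simp [hF]
  rw [total_eq_sum h1, total_eq_sum h2, ← Finset.add_sum_erase _ _ hvF,
    ← Finset.add_sum_erase _ _ hwF, ← Finset.add_sum_erase F _ hvF,
    ← Finset.add_sum_erase _ _ hwF, move_source hv hvw, move_target hv hvw]
  have h3 : ∑ u ∈ (F.erase v).erase w, ζ.move v w u = ∑ u ∈ (F.erase v).erase w, ζ u := by
    refine Finset.sum_congr rfl fun u hu => ?_
    simp only [Finset.mem_erase] at hu
    exact move_other hu.2.1 hu.1
  omega

/-- Every configuration with more than `k` particles dominates one with exactly `m ≤ k + 1`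
particles. -/
theorem exists_le_total_eq (η : Config V) {k : ℕ} (h : ¬ (η.IsFinite ∧ η.total ≤ k)) :
    ∀ m ≤ k + 1, ∃ ζ : Config V, ζ ≤ η ∧ ζ.IsFinite ∧ ζ.total = m := by
  classical
  intro m
  induction m with
  | zero => exact fun _ => ⟨0, fun v => Nat.zero_le _, by simp [IsFinite], by simp [total]⟩
  | succ m ih =>
    intro hm
    obtain ⟨ζ, hle, hfin, htot⟩ := ih (by omega)
    have hne : ∃ v, ζ v < η v := by
      by_contra! hcon
      have : ζ = η := le_antisymm hle hcon
      subst this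
      exact h ⟨hfin, by omega⟩
    obtain ⟨v, hv⟩ := hne
    have hF : ∀ u, ζ u ≠ 0 → u ∈ insert v hfin.sites := fun u hu => by simp [hu]
    have hF' : ∀ u, (ζ + Pi.single v 1 : V → ℕ) u ≠ 0 → u ∈ insert v hfin.sites := by
      intro u hu
      by_contra hcon
      simp only [Finset.mem_insert, IsFinite.mem_sites, not_or, not_not] at hcon
      exact hu (by simp [hcon.1, hcon.2])
    refine ⟨(ζ + Pi.single v 1 : V → ℕ), ?_, (Finset.finite_toSet _).subset hF', ?_⟩
    · intro u
      by_cases hu : u = v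
      · subst hu; simpa using hv
      · simpa [hu] using hle u
    · rw [total_eq_sum hF', ← htot, total_eq_sum hF]
      simp [Finset.sum_add_distrib]

/-- A finite configuration is maximal among those with the same number of particles. -/
theorem eq_of_le_of_total_le {ζ η : Config V} (hle : ζ ≤ η) (hη : η.IsFinite)
    (h : η.total ≤ ζ.total) : ζ = η := by
  have h1 : ∀ u, η u ≠ 0 → u ∈ hη.sites := fun u hu => by simpa using hu
  have h2 : ∀ u, ζ u ≠ 0 → u ∈ hη.sites := fun u hu =>
    h1 u (by have : ζ u ≤ η u := hle u; omega)
  rw [total_eq_sum h1, total_eq_sum h2] at h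
  ext u
  by_cases hu : η u = 0
  · have : ζ u ≤ η u := hle u
    omega
  · exact (Finset.sum_eq_sum_iff_of_le fun v _ => hle v).1
      (le_antisymm (Finset.sum_le_sum fun v _ => hle v) h) u (h1 u hu)

theorem countable_isFinite [Countable V] : {ζ : Config V | ζ.IsFinite}.Countable := by
  have : Set.range (fun f : V →₀ ℕ => (f : V → ℕ)) = {ζ : Config V | ζ.IsFinite} := by
    ext ζ
    constructor
    · rintro ⟨f, rfl⟩
      exact f.hasFiniteSupport
    · intro h
      exact ⟨Finsupp.ofSupportFinite ζ h, rfl⟩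
  rw [← this]
  exact Set.countable_range _

end Config

/-! ### Factorized duality functions built from falling factorials -/

variable {V : Type*}

/-- The duality function `∏_v β(ξ_v) η_v! / (η_v - ξ_v)!`. -/
def fallingDual (β : ℕ → ℝ) (ξ η : Config V) : ℝ :=
  factorized (fun k n => β k * n.descFactorial k) ξ η

section fallingDual

variable {β : ℕ → ℝ}

theorem fallingDual_eq_prod (h0 : β 0 = 1) {ξ : Config V} {F : Finset V}
    (h : ∀ v, ξ v ≠ 0 → v ∈ F) (η : Config V) :
    fallingDual β ξ η = ∏ v ∈ F, β (ξ v) * (η v).descFactorial (ξ v) := by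
  refine finprod_eq_prod_of_mulSupport_subset _ fun v hv => h v fun hv0 => hv ?_
  simp [hv0, h0]

theorem fallingDual_congr (h0 : β 0 = 1) {ξ η η' : Config V} {F : Finset V}
    (h : ∀ v, ξ v ≠ 0 → v ∈ F) (hη : ∀ v ∈ F, η v = η' v) :
    fallingDual β ξ η = fallingDual β ξ η' := by
  rw [fallingDual_eq_prod h0 h, fallingDual_eq_prod h0 h]
  exact Finset.prod_congr rfl fun v hv => by rw [hη v hv]

theorem fallingDual_nonneg (hβ : ∀ k, 0 < β k) (ξ η : Config V) : 0 ≤ fallingDual β ξ η := by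
  refine finprod_nonneg fun v => ?_
  have := hβ (ξ v)
  positivity

/-- A falling factorial of n of order k vanishes exactly when k > n. The duality function thus
detects domination, which is how the law of the dual process is read off from it. -/
theorem fallingDual_pos_iff (h0 : β 0 = 1) (hβ : ∀ k, 0 < β k) {ξ : Config V} (hξ : ξ.IsFinite)
    (η : Config V) : 0 < fallingDual β ξ η ↔ ξ ≤ η := by
  have h : ∀ v, ξ v ≠ 0 → v ∈ hξ.sites := fun v hv => by simpa using hv
  constructor
  · intro hpos v
    by_contra hlt
    rw [not_le] at hlt
    have hv : v ∈ hξ.sites := h v (Nat.ne_of_gt (Nat.zero_lt_of_lt hlt))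
    rw [fallingDual_eq_prod h0 h, Finset.prod_eq_zero hv] at hpos
    · exact lt_irrefl _ hpos
    · rw [Nat.descFactorial_eq_zero_iff_lt.2 hlt]; simp
  · intro hle
    rw [fallingDual_eq_prod h0 h]
    refine Finset.prod_pos fun v _ => mul_pos (hβ _) ?_
    have : (η v).descFactorial (ξ v) ≠ 0 := by
      rw [Ne, Nat.descFactorial_eq_zero_iff_lt, not_lt]
      exact hle v
    positivity

theorem fallingDual_eq_zero (h0 : β 0 = 1) (hβ : ∀ k, 0 < β k) {ξ : Config V} (hξ : ξ.IsFinite)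
    {η : Config V} (h : ¬ ξ ≤ η) : fallingDual β ξ η = 0 :=
  le_antisymm (not_lt.1 fun hpos => h ((fallingDual_pos_iff h0 hβ hξ η).1 hpos))
    (fallingDual_nonneg hβ ξ η)

end fallingDual

/-! ### Generators as finite sums -/

namespace ParticleSystem

/-- `F` contains `Λ` and all sites connected to `Λ` by a positive rate. -/
def Absorbs (A : ParticleSystem V) (Λ F : Finset V) : Prop :=
  Λ ⊆ F ∧ ∀ v ∈ Λ, ∀ w, (A.rate v w ≠ 0 ∨ A.rate w v ≠ 0) → w ∈ F

theorem exists_absorbs {A : ParticleSystem V}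
    (h : ∀ v, {w | A.rate v w ≠ 0 ∨ A.rate w v ≠ 0}.Finite) (Λ : Finset V) :
    ∃ F, A.Absorbs Λ F := by
  classical
  refine ⟨Λ ∪ Λ.biUnion fun v => (h v).toFinset, Finset.subset_union_left, ?_⟩
  intro v hv w hw
  refine Finset.mem_union_right _ (Finset.mem_biUnion.2 ⟨v, hv, ?_⟩)
  simpa using hw

/-- The rate at which a particle jumps from `e.1` to `e.2`. -/
def jumpRate (A : ParticleSystem V) (η : Config V) (e : V × V) : ℝ :=
  A.rate e.1 e.2 * (η e.1 : ℝ) * (A.α + A.s * (η e.2 : ℝ))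

theorem generator_eq_sum_of_cylinder {A : ParticleSystem V} {f : Config V → ℝ} {Λ F : Finset V}
    (hf : ∀ η ζ : Config V, (∀ v ∈ Λ, η v = ζ v) → f η = f ζ) (hF : A.Absorbs Λ F)
    (η : Config V) :
    A.generator f η = ∑ e ∈ F ×ˢ F, A.jumpRate η e * (f (η.move e.1 e.2) - f η) := by
  refine finsum_eq_sum_of_support_subset _ fun e he => ?_
  obtain ⟨v, w⟩ := e
  simp only [Function.mem_support, ne_eq, mul_eq_zero, not_or, sub_eq_zero] at he
  obtain ⟨⟨⟨hr, -⟩, -⟩, hne⟩ := he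
  have : v ∈ Λ ∨ w ∈ Λ := by
    by_contra! hcon
    refine hne (hf _ _ fun u hu => Config.move_other ?_ ?_)
    · rintro rfl; exact hcon.1 hu
    · rintro rfl; exact hcon.2 hu
  simp only [Finset.coe_product, Set.mem_prod, Finset.mem_coe]
  rcases this with hv | hw
  · exact ⟨hF.1 hv, hF.2 v hv w (Or.inl hr)⟩
  · exact ⟨hF.2 w hw v (Or.inr hr), hF.1 hw⟩

theorem generator_eq_sum_of_finite {A : ParticleSystem V} {ζ : Config V} {Λ F : Finset V}
    (hζ : ∀ v, ζ v ≠ 0 → v ∈ Λ) (hF : A.Absorbs Λ F) (f : Config V → ℝ) :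
    A.generator f ζ = ∑ e ∈ F ×ˢ F, A.jumpRate ζ e * (f (ζ.move e.1 e.2) - f ζ) := by
  refine finsum_eq_sum_of_support_subset _ fun e he => ?_
  obtain ⟨v, w⟩ := e
  simp only [Function.mem_support, ne_eq, mul_eq_zero, not_or] at he
  obtain ⟨⟨⟨hr, hv⟩, -⟩, -⟩ := he
  have hv : v ∈ Λ := hζ v (by exact_mod_cast hv)
  simp only [Finset.coe_product, Set.mem_prod, Finset.mem_coe]
  exact ⟨hF.1 hv, hF.2 v hv w (Or.inl hr)⟩

end ParticleSystem

/-! ### Generator duality -/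

/-- Structural assumptions on a pair of particle systems under which they are dual with respect to
`fallingDual β`: the rates of `B` are those of `A` reversed, they are doubly balanced and bounded,
and the admissible occupation numbers are given by the predicate `ok`. -/
structure DualityPair (A B : ParticleSystem V) (ok : ℕ → Prop) (β : ℕ → ℝ) : Prop where
  rate_swap : ∀ v w, B.rate v w = A.rate w v
  α_eq : B.α = A.α
  s_eq : B.s = A.s
  space_left : A.space = {η | ∀ v, ok (η v)}
  space_right : B.space = {η | ∀ v, ok (η v)}
  rate_nonneg : ∀ v w, 0 ≤ A.rate v w
  finite_range : ∀ v, {w | A.rate v w ≠ 0 ∨ A.rate w v ≠ 0}.Finite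
  balance : ∀ v, ∑ᶠ w, A.rate v w = ∑ᶠ w, A.rate w v
  rate_le : ∃ M, ∀ v, ∑ᶠ w, A.rate v w ≤ M
  symm_of_ne : A.s = 0 ∨ ∀ v w, A.rate v w = A.rate w v
  ok_of_le : ∀ {m n}, ok n → m ≤ n → ok m
  factor_nonneg : ∀ {n : ℕ}, ok n → 0 ≤ A.α + A.s * n
  factor_eq_zero : ∀ {n : ℕ}, ok n → ¬ ok (n + 1) → A.α + A.s * n = 0
  weight_zero : β 0 = 1
  weight_pos : ∀ k, 0 < β k
  weight_succ : ∃ γ : ℝ, ∀ k : ℕ, ok (k + 1) → γ * β k = β (k + 1) * (A.α + A.s * k)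

namespace DualityPair

variable {A B : ParticleSystem V} {ok : ℕ → Prop} {β : ℕ → ℝ}

theorem symm (h : DualityPair A B ok β) : DualityPair B A ok β where
  rate_swap v w := (h.rate_swap w v).symm
  α_eq := h.α_eq.symm
  s_eq := h.s_eq.symm
  space_left := h.space_right
  space_right := h.space_left
  rate_nonneg v w := by rw [h.rate_swap]; exact h.rate_nonneg w v
  finite_range v := by simpa only [h.rate_swap, or_comm] using h.finite_range v
  balance v := by simp only [h.rate_swap]; exact (h.balance v).symm
  rate_le := by
    obtain ⟨M, hM⟩ := h.rate_le
    refine ⟨M, fun v => ?_⟩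
    simp only [h.rate_swap]
    rw [← h.balance]
    exact hM v
  symm_of_ne := by
    rw [h.s_eq]
    refine h.symm_of_ne.imp_right fun h' v w => ?_
    rw [h.rate_swap, h.rate_swap, h']
  ok_of_le := h.ok_of_le
  factor_nonneg := by rw [h.s_eq, h.α_eq]; exact h.factor_nonneg
  factor_eq_zero := by rw [h.s_eq, h.α_eq]; exact h.factor_eq_zero
  weight_zero := h.weight_zero
  weight_pos := h.weight_pos
  weight_succ := by rw [h.s_eq, h.α_eq]; exact h.weight_succ

/-- The algebraic identity behind the duality: the action of moving a particle from a site with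
occupation numbers `(a, m)` to a site with occupation numbers `(b, n)`. -/
theorem bond_identity {α s γ : ℝ} (hβ : ∀ k : ℕ, ok (k + 1) → γ * β k = β (k + 1) * (α + s * k))
    (hok : ∀ {m n}, ok n → m ≤ n → ok m) (a b : ℕ) {m n : ℕ} (hb : ok b) (hm : ok m) :
    (m : ℝ) * (α + s * n) * (β a * (m - 1).descFactorial a * (β b * (n + 1).descFactorial b)
        - β a * m.descFactorial a * (β b * n.descFactorial b))
      = b * (α + s * a)
          * (β (a + 1) * m.descFactorial (a + 1) * (β (b - 1) * n.descFactorial (b - 1)))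
        - a * (α + s * b) * (β a * m.descFactorial a * (β b * n.descFactorial b))
        + s * (β a * β b * (b * m.descFactorial (a + 1) * n.descFactorial b
            - a * m.descFactorial a * n.descFactorial (b + 1))) := by
  have e1 : (m : ℝ) * (m - 1).descFactorial a = m.descFactorial (a + 1) := by
    rcases m with _ | m
    · simp
    · rw [Nat.succ_descFactorial_succ]; simp
  have e2 : (m.descFactorial (a + 1) : ℝ) = (m - a) * m.descFactorial a := by
    rw [Nat.descFactorial_succ]
    rcases le_or_gt a m with h | h
    · push_cast [Nat.cast_sub h]; ring
    · rw [Nat.descFactorial_eq_zero_iff_lt.2 h]; simp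
  have e3 : ∀ b : ℕ, (n.descFactorial (b + 1) : ℝ) = (n - b) * n.descFactorial b := by
    intro b
    rw [Nat.descFactorial_succ]
    rcases le_or_gt b n with h | h
    · push_cast [Nat.cast_sub h]; ring
    · rw [Nat.descFactorial_eq_zero_iff_lt.2 h]; simp
  -- The weight relation is available only when a + 1 is admissible. For a < m this follows from `ok
  -- m`; otherwise the falling factorial is zero.
  have e4 : γ * β a * (m.descFactorial (a + 1) : ℝ)
      = β (a + 1) * (α + s * a) * m.descFactorial (a + 1) := by
    rcases lt_or_ge a m with h | h
    · rw [hβ a (hok hm h)]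
    · rw [Nat.descFactorial_eq_zero_iff_lt.2 (Nat.lt_succ_of_le h)]; simp
  rcases b with _ | b
  · simp only [Nat.descFactorial_zero, e2, e3, Nat.cast_zero]
    have : (m : ℝ) * (α + s * n) * (β a * ((m - 1).descFactorial a : ℝ) * (β 0 * ((1 : ℕ) : ℝ)))
        = (α + s * n) * β a * β 0 * ((m : ℝ) * (m - 1).descFactorial a) := by push_cast; ring
    rw [mul_sub, this, e1, e2]
    push_cast
    ring
  · have e5 := hβ b hb
    have e6 : ((n + 1).descFactorial (b + 1) : ℝ) = (n + 1) * n.descFactorial b := by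
      rw [Nat.succ_descFactorial_succ]; push_cast; ring
    have e7 : (m : ℝ) * (α + s * n) * (β a * ((m - 1).descFactorial a : ℝ)
          * (β (b + 1) * ((n + 1).descFactorial (b + 1) : ℝ)))
        = (α + s * n) * β a * β (b + 1) * (n + 1) * n.descFactorial b
          * m.descFactorial (a + 1) := by
      rw [e6, ← e1]; ring
    have e8 : ((b + 1 : ℕ) : ℝ) * (α + s * a) * (β (a + 1) * (m.descFactorial (a + 1) : ℝ)
          * (β b * (n.descFactorial b : ℝ)))
        = (b + 1) * β (b + 1) * (α + s * b) * β a * n.descFactorial b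
          * m.descFactorial (a + 1) := by
      push_cast
      linear_combination (-((b : ℝ) + 1) * β b * n.descFactorial b) * e4
        + ((b : ℝ) + 1) * n.descFactorial b * β a * m.descFactorial (a + 1) * e5
    rw [mul_sub, e7, Nat.add_sub_cancel, e8, e3 (b + 1), e3 b, e2]
    push_cast
    ring

/-- The contribution to the generator that is antisymmetric in the two sites. -/
theorem exists_bond_correction (h : DualityPair A B ok β) {ζ η : Config V} {F : Finset V}
    (hζF : ∀ v, ζ v ≠ 0 → v ∈ F) (hζ : ∀ v, ok (ζ v)) (hη : ∀ v, ok (η v)) :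
    ∃ J : V → V → ℝ, (∀ v w, J v w = -J w v) ∧ ∀ v ∈ F, ∀ w ∈ F,
      (η v : ℝ) * (A.α + A.s * η w)
          * (fallingDual β ζ (η.move v w) - fallingDual β ζ η)
        = ζ w * (A.α + A.s * ζ v) * fallingDual β (ζ.move w v) η
          - ζ v * (A.α + A.s * ζ w) * fallingDual β ζ η + A.s * J v w := by
  classical
  obtain ⟨γ, hγ⟩ := h.weight_succ
  -- The common factor of the sites untouched by a move between v and w. It is symmetric in v and w,
  -- so antisymmetry only has to be checked on the two-site factor.
  set R : V → V → ℝ := fun v w =>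
    ∏ u ∈ (F.erase v).erase w, β (ζ u) * (η u).descFactorial (ζ u) with hR
  refine ⟨fun v w => if v = w then 0 else
    R v w * (β (ζ v) * β (ζ w) * (ζ w * (η v).descFactorial (ζ v + 1) * (η w).descFactorial (ζ w)
      - ζ v * (η v).descFactorial (ζ v) * (η w).descFactorial (ζ w + 1))), ?_, ?_⟩
  · intro v w
    by_cases hvw : v = w
    · simp [hvw]
    · have : R v w = R w v := by simp only [hR]; rw [Finset.erase_right_comm]
      simp only [if_neg hvw, if_neg (Ne.symm hvw), this]
      ring
  · intro v hv w hw
    by_cases hvw : v = w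
    · subst hvw
      simp [Config.move_self]
    simp only [if_neg hvw]
    have hw' : w ∈ F.erase v := by simp [Ne.symm hvw, hw]
    have hsplit : ∀ g : V → ℝ, ∏ u ∈ F, g u = g v * (g w * ∏ u ∈ (F.erase v).erase w, g u) := by
      intro g
      rw [Finset.mul_prod_erase _ _ hw', Finset.mul_prod_erase _ _ hv]
    have hout : ∀ u ∈ (F.erase v).erase w, u ≠ v ∧ u ≠ w := by
      intro u hu
      simp only [Finset.mem_erase] at hu
      exact ⟨hu.2.1, hu.1⟩
    have d0 : fallingDual β ζ η = β (ζ v) * (η v).descFactorial (ζ v)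
        * (β (ζ w) * (η w).descFactorial (ζ w)) * R v w := by
      rw [fallingDual_eq_prod h.weight_zero hζF, hsplit]; ring
    -- The factor η v stays in the equation: for an empty site the truncated η v - 1 does not
    -- describe the move, but both sides are then zero.
    have d1 : (η v : ℝ) * fallingDual β ζ (η.move v w)
        = η v * (β (ζ v) * (η v - 1).descFactorial (ζ v)
        * (β (ζ w) * (η w + 1).descFactorial (ζ w)) * R v w) := by
      by_cases h0 : η v = 0
      · simp [h0]
      · rw [fallingDual_eq_prod h.weight_zero hζF, hsplit, Config.move_source h0 hvw,
          Config.move_target h0 hvw, Finset.prod_congr rfl fun u hu => by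
            rw [Config.move_other (hout u hu).1 (hout u hu).2]]
        ring
    have d2 : (ζ w : ℝ) * fallingDual β (ζ.move w v) η
        = ζ w * (β (ζ v + 1) * (η v).descFactorial (ζ v + 1)
        * (β (ζ w - 1) * (η w).descFactorial (ζ w - 1)) * R v w) := by
      by_cases h0 : ζ w = 0
      · simp [h0]
      · have hmF : ∀ u, ζ.move w v u ≠ 0 → u ∈ F := by
          intro u hu
          by_contra hcon
          refine hu (Config.move_eq_zero ?_ ?_)
          · by_contra h; exact hcon (hζF u h)
          · rintro rfl; exact hcon hv
        rw [fallingDual_eq_prod h.weight_zero hmF, hsplit, Config.move_source h0 (Ne.symm hvw),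
          Config.move_target h0 (Ne.symm hvw), Finset.prod_congr rfl fun u hu => by
            rw [Config.move_other (hout u hu).2 (hout u hu).1]]
        ring
    have key := bond_identity hγ h.ok_of_le (ζ v) (ζ w) (n := η w) (hζ w) (hη v)
    have d1' : (η v : ℝ) * (A.α + A.s * η w)
          * (fallingDual β ζ (η.move v w) - fallingDual β ζ η)
        = (A.α + A.s * η w) * (η v * fallingDual β ζ (η.move v w))
          - η v * (A.α + A.s * η w) * fallingDual β ζ η := by ring
    have d2' : (ζ w : ℝ) * (A.α + A.s * ζ v) * fallingDual β (ζ.move w v) η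
        = (A.α + A.s * ζ v) * (ζ w * fallingDual β (ζ.move w v) η) := by ring
    rw [d1', d1, d2', d2, d0]
    linear_combination R v w * key

/-- A jump from v to w in η is matched with the reversed jump from w to v in ζ. The bond identities
are summed over one finite set containing all bonds that contribute to either side; the two error
terms then cancel. -/
theorem generator_duality (h : DualityPair A B ok β) {ζ η : Config V} (hfin : ζ.IsFinite)
    (hζ : ∀ v, ok (ζ v)) (hη : ∀ v, ok (η v)) :
    A.generator (fallingDual β ζ) η = B.generator (fun x => fallingDual β x η) ζ := by
  have hΛ : ∀ v, ζ v ≠ 0 → v ∈ hfin.sites := fun v hv => by simpa using hv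
  obtain ⟨F, hF⟩ := ParticleSystem.exists_absorbs h.finite_range hfin.sites
  have hFB : B.Absorbs hfin.sites F := by
    refine ⟨hF.1, fun v hv w hw => hF.2 v hv w ?_⟩
    rwa [h.rate_swap, h.rate_swap, or_comm] at hw
  have hζF : ∀ v, ζ v ≠ 0 → v ∈ F := fun v hv => hF.1 (hΛ v hv)
  rw [ParticleSystem.generator_eq_sum_of_cylinder
      (fun _ _ => fallingDual_congr h.weight_zero hΛ) hF,
    ParticleSystem.generator_eq_sum_of_finite hΛ hFB]
  obtain ⟨J, hJ, hbond⟩ := h.exists_bond_correction hζF hζ hη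
  set D := fallingDual β ζ η with hD
  have hsumJ : ∑ e ∈ F ×ˢ F, A.rate e.1 e.2 * (A.s * J e.1 e.2) = 0 := by
    rcases h.symm_of_ne with hs | hs
    · simp [hs]
    · have : ∑ e ∈ F ×ˢ F, A.rate e.1 e.2 * (A.s * J e.1 e.2)
          = -∑ e ∈ F ×ˢ F, A.rate e.1 e.2 * (A.s * J e.1 e.2) := by
        conv_lhs => rw [Finset.sum_product_right, ← Finset.sum_product']
        rw [← Finset.sum_neg_distrib]
        refine Finset.sum_congr rfl fun e _ => ?_
        simp only
        rw [hJ e.2 e.1, hs e.2 e.1]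
        ring
      linarith
  -- The coefficient of ζ v is incoming minus outgoing rate at v. Restricting the sums to F loses
  -- nothing at occupied sites, since F contains all their neighbours.
  have hbal : ∑ e ∈ F ×ˢ F, A.rate e.1 e.2 * ((ζ e.2 : ℝ) - ζ e.1) = 0 := by
    simp_rw [mul_sub]
    rw [Finset.sum_sub_distrib, Finset.sum_product_right, Finset.sum_product, sub_eq_zero]
    refine Finset.sum_congr rfl fun v _ => ?_
    simp only
    rw [← Finset.sum_mul, ← Finset.sum_mul]
    by_cases hv : ζ v = 0
    · simp [hv]
    · have hvΛ := hΛ v hv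
      have e1 := h.balance v
      rw [finsum_eq_sum_of_support_subset (s := F) _ fun w hw => hF.2 v hvΛ w (Or.inl hw),
        finsum_eq_sum_of_support_subset (s := F) _ fun w hw => hF.2 v hvΛ w (Or.inr hw)] at e1
      rw [e1]
  have hswap : ∑ e ∈ F ×ˢ F, B.jumpRate ζ e * (fallingDual β (ζ.move e.1 e.2) η - D)
      = ∑ e ∈ F ×ˢ F, A.rate e.1 e.2 * (ζ e.2 * (A.α + A.s * ζ e.1)
        * (fallingDual β (ζ.move e.2 e.1) η - D)) := by
    rw [Finset.sum_product_right, ← Finset.sum_product']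
    refine Finset.sum_congr rfl fun e _ => ?_
    simp only [ParticleSystem.jumpRate]
    rw [h.rate_swap, h.α_eq, h.s_eq]
    ring
  have hleft : ∀ e ∈ F ×ˢ F, A.jumpRate η e * (fallingDual β ζ (η.move e.1 e.2) - D)
      = A.rate e.1 e.2 * (ζ e.2 * (A.α + A.s * ζ e.1) * (fallingDual β (ζ.move e.2 e.1) η - D))
        + A.α * D * (A.rate e.1 e.2 * ((ζ e.2 : ℝ) - ζ e.1))
        + A.rate e.1 e.2 * (A.s * J e.1 e.2) := by
    intro e he
    rw [Finset.mem_product] at he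
    have := hbond e.1 he.1 e.2 he.2
    simp only [ParticleSystem.jumpRate]
    linear_combination A.rate e.1 e.2 * this
  rw [hswap, Finset.sum_congr rfl hleft, Finset.sum_add_distrib, Finset.sum_add_distrib,
    ← Finset.mul_sum, hbal, hsumJ]
  ring

end DualityPair

end

section

/-! ### The generator on finite configurations -/

/-- Admissible configurations with exactly `k` particles. -/
def levelSet (V : Type*) (ok : ℕ → Prop) (k : ℕ) : Set (Config V) :=
  {ζ | ζ.IsFinite ∧ (∀ v, ok (ζ v)) ∧ ζ.total = k}

variable {V : Type*}

/-- The generator, shifted by a constant in order to become a positive operator. -/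
def ParticleSystem.shiftedGenerator (A : ParticleSystem V) (Λ : ℝ) (f : Config V → ℝ)
    (ζ : Config V) : ℝ :=
  Λ * f ζ + A.generator f ζ

theorem ParticleSystem.shiftedGenerator_one (A : ParticleSystem V) (Λ : ℝ) (ζ : Config V) :
    A.shiftedGenerator Λ (fun _ => 1) ζ = Λ := by
  simp [shiftedGenerator, generator]

namespace DualityPair

variable {A B : ParticleSystem V} {ok : ℕ → Prop} {β : ℕ → ℝ}

theorem jumpRate_nonneg (h : DualityPair A B ok β) {η : Config V} (hη : ∀ v, ok (η v))
    (e : V × V) : 0 ≤ A.jumpRate η e :=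
  mul_nonneg (mul_nonneg (h.rate_nonneg _ _) (Nat.cast_nonneg _)) (h.factor_nonneg (hη _))

/-- Only the target site can become inadmissible, and `factor_eq_zero` gives such a jump rate zero.
-/
theorem ok_move (h : DualityPair A B ok β) {η : Config V} (hη : ∀ v, ok (η v)) {e : V × V}
    (he : A.jumpRate η e ≠ 0) (u : V) : ok (η.move e.1 e.2 u) := by
  obtain ⟨v, w⟩ := e
  simp only [ParticleSystem.jumpRate, ne_eq, mul_eq_zero, not_or] at he
  obtain ⟨⟨-, hv⟩, hw⟩ := he
  have hv : η v ≠ 0 := by exact_mod_cast hv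
  by_cases hvw : v = w
  · subst hvw; rw [Config.move_self]; exact hη u
  by_cases hu : u = v
  · subst hu; rw [Config.move_source hv hvw]; exact h.ok_of_le (hη u) (Nat.sub_le _ _)
  by_cases hu' : u = w
  · subst hu'
    rw [Config.move_target hv hvw]
    by_contra hcon
    exact hw (h.factor_eq_zero (hη u) hcon)
  · rw [Config.move_other hu hu']; exact hη u

/-- No site holds more than `ζ.total` particles, so each particle jumps at rate at most (|α| +
|s|·total)·M. The bound depends on ζ only through its particle number, so one shift Λ serves a whole
level. -/
theorem sum_jumpRate_le (h : DualityPair A B ok β) {M : ℝ} (hM : ∀ v, ∑ᶠ w, A.rate v w ≤ M)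
    {ζ : Config V} {Λ F : Finset V} (hζ : ∀ v, ζ v ≠ 0 → v ∈ Λ) (hF : A.Absorbs Λ F) :
    ∑ e ∈ F ×ˢ F, A.jumpRate ζ e ≤ ζ.total * (|A.α| + |A.s| * ζ.total) * M := by
  have hζF : ∀ v, ζ v ≠ 0 → v ∈ F := fun v hv => hF.1 (hζ v hv)
  have htot := Config.total_eq_sum hζF
  have hfac : ∀ w ∈ F, A.α + A.s * ζ w ≤ |A.α| + |A.s| * ζ.total := by
    intro w hw
    have h1 : (ζ w : ℝ) ≤ ζ.total := by
      rw [htot]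
      exact_mod_cast Finset.single_le_sum (f := ζ) (fun _ _ => Nat.zero_le _) hw
    have h2 : A.s * ζ w ≤ |A.s| * ζ w :=
      mul_le_mul_of_nonneg_right (le_abs_self _) (Nat.cast_nonneg _)
    have h3 : |A.s| * ζ w ≤ |A.s| * ζ.total := mul_le_mul_of_nonneg_left h1 (abs_nonneg _)
    linarith [le_abs_self A.α]
  set c := |A.α| + |A.s| * ζ.total with hc
  have hc0 : 0 ≤ c := by positivity
  have hrow : ∀ v ∈ F, ∑ w ∈ F, A.jumpRate ζ (v, w) ≤ ζ v * (c * M) := by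
    intro v _
    by_cases hv : ζ v = 0
    · simp [ParticleSystem.jumpRate, hv]
    calc ∑ w ∈ F, A.jumpRate ζ (v, w) ≤ ∑ w ∈ F, A.rate v w * ζ v * c :=
          Finset.sum_le_sum fun w hw => mul_le_mul_of_nonneg_left (hfac w hw)
            (mul_nonneg (h.rate_nonneg _ _) (Nat.cast_nonneg _))
      _ = ζ v * (c * ∑ w ∈ F, A.rate v w) := by
          rw [← Finset.sum_mul, ← Finset.sum_mul]; ring
      _ ≤ ζ v * (c * M) := by
          have := hM v
          rw [finsum_eq_sum_of_support_subset (s := F) _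
            fun w hw => hF.2 v (hζ v hv) w (Or.inl hw)] at this
          gcongr
  rw [Finset.sum_product]
  refine (Finset.sum_le_sum hrow).trans (le_of_eq ?_)
  rw [← Finset.sum_mul, htot]
  push_cast
  ring

theorem exists_isKernelOn (h : DualityPair A B ok β) (k : ℕ) : ∃ Λ₀ : ℝ, ∀ Λ, Λ₀ ≤ Λ →
    IsKernelOn (Option (V × V)) (A.shiftedGenerator Λ) (levelSet V ok k) := by
  classical
  obtain ⟨M, hM⟩ := h.rate_le
  refine ⟨k * (|A.α| + |A.s| * k) * M, fun Λ hΛ ζ hζ => ?_⟩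
  obtain ⟨hfin, hok, htot⟩ := hζ
  have hs : ∀ v, ζ v ≠ 0 → v ∈ hfin.sites := fun v hv => by simpa using hv
  obtain ⟨F, hF⟩ := ParticleSystem.exists_absorbs h.finite_range hfin.sites
  have hsum := h.sum_jumpRate_le hM hs hF
  rw [htot] at hsum
  -- The label `none` stands for staying put, with the leftover weight of Λ. Jumps of rate zero are
  -- discarded because their targets may be inadmissible.
  refine ⟨((F ×ˢ F).filter fun e => A.jumpRate ζ e ≠ 0).insertNone,
    fun o => o.elim ζ fun e => ζ.move e.1 e.2,
    fun o => o.elim (Λ - ∑ e ∈ F ×ˢ F, A.jumpRate ζ e) (A.jumpRate ζ), ?_, ?_, ?_⟩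
  · rintro (_ | e) he
    · exact ⟨hfin, hok, htot⟩
    · simp only [Finset.some_mem_insertNone, Finset.mem_filter] at he
      obtain ⟨h1, h2⟩ := Config.total_move hfin e.1 e.2
      exact ⟨h1, h.ok_move hok he.2, h2.trans htot⟩
  · rintro (_ | e) he
    · simp only [Option.elim_none]
      linarith
    · exact h.jumpRate_nonneg hok e
  · intro f
    rw [Finset.sum_insertNone, ParticleSystem.shiftedGenerator,
      ParticleSystem.generator_eq_sum_of_finite hs hF]
    simp only [Option.elim_none, Option.elim_some]
    rw [Finset.sum_filter_of_ne fun e _ he => left_ne_zero_of_mul he]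
    simp_rw [mul_sub]
    rw [Finset.sum_sub_distrib, ← Finset.sum_mul]
    ring

theorem exists_isKernelOn_pair (h : DualityPair A B ok β) (k : ℕ) : ∃ Λ : ℝ,
    IsKernelOn (Option (V × V)) (A.shiftedGenerator Λ) (levelSet V ok k) ∧
    IsKernelOn (Option (V × V)) (B.shiftedGenerator Λ) (levelSet V ok k) := by
  obtain ⟨Λ₁, h₁⟩ := h.exists_isKernelOn k
  obtain ⟨Λ₂, h₂⟩ := h.symm.exists_isKernelOn k
  exact ⟨max Λ₁ Λ₂, h₁ _ (le_max_left _ _), h₂ _ (le_max_right _ _)⟩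

/-- Duality of all powers of the shifted generators on finite configurations. -/
theorem iterate_duality (h : DualityPair A B ok β) {k : ℕ} {Λ : ℝ}
    (hA : IsKernelOn (Option (V × V)) (A.shiftedGenerator Λ) (levelSet V ok k))
    (hB : IsKernelOn (Option (V × V)) (B.shiftedGenerator Λ) (levelSet V ok k)) (n : ℕ) :
    ∀ ζ ∈ levelSet V ok k, ∀ ξ ∈ levelSet V ok k,
      (A.shiftedGenerator Λ)^[n] (fun x => fallingDual β x ξ) ζ
        = (B.shiftedGenerator Λ)^[n] (fallingDual β ζ) ξ := by
  induction n with
  | zero => intro ζ _ ξ _; rfl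
  | succ n ih =>
    intro ζ hζ ξ hξ
    obtain ⟨I, y, b, hy, -, hrep⟩ := hB ξ hξ
    -- The innermost application of the `A`-operator is traded for one of the `B`-operator in the
    -- other variable. Its coefficients do not depend on x, so the remaining powers pass through the
    -- sum.
    have hstep : ∀ x ∈ levelSet V ok k, A.shiftedGenerator Λ (fun x => fallingDual β x ξ) x
        = ∑ i ∈ I, b i * fallingDual β x (y i) := by
      intro x hx
      rw [← hrep, ParticleSystem.shiftedGenerator, ParticleSystem.shiftedGenerator,
        h.symm.generator_duality hx.1 hx.2.1 hξ.2.1]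
    rw [Function.iterate_succ_apply, hA.iterate_congr hstep n ζ hζ,
      hA.iterate_sum I b (fun i x => fallingDual β x (y i)) n ζ hζ,
      Function.iterate_succ_apply', hrep]
    exact Finset.sum_congr rfl fun i hi => by rw [ih ζ hζ _ (hy i hi)]

end DualityPair

end

section

/-! ### Cylinder functions of polynomial growth -/

variable {V : Type*}

/-- One plus the number of particles in `F`. -/
def Config.size (F : Finset V) (η : Config V) : ℕ := 1 + ∑ v ∈ F, η v

/-- `f` depends only on the coordinates in `Λ`. -/
def DependsOnSites (f : Config V → ℝ) (Λ : Finset V) : Prop :=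
  ∀ η ζ : Config V, (∀ v ∈ Λ, η v = ζ v) → f η = f ζ

/-- Such a function factors through the countable discrete space `Λ → ℕ`. -/
theorem DependsOnSites.measurable {f : Config V → ℝ} {Λ : Finset V} (hf : DependsOnSites f Λ) :
    Measurable f := by
  classical
  have h : f = (fun x : Λ → ℕ => f fun v => if h : v ∈ Λ then x ⟨v, h⟩ else 0) ∘
      fun (η : Config V) (v : Λ) => η v := by
    ext η
    refine hf _ _ fun v hv => ?_
    simp [hv]
  rw [h]
  exact (Measurable.of_discrete).comp (measurable_pi_lambda _ fun v => measurable_pi_apply _)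

theorem Config.size_pow_le (F : Finset V) (n : ℕ) :
    ∃ C : ℕ, ∀ η : Config V, η.size F ^ n ≤ C * (1 + ∑ v ∈ F, η v ^ n) := by
  classical
  induction F using Finset.induction_on with
  | empty => exact ⟨1, fun η => by simp [size]⟩
  | insert v F hv ih =>
    obtain ⟨C, hC⟩ := ih
    refine ⟨2 ^ n * (C + 1), fun η => ?_⟩
    have h1 : η.size (insert v F) = η.size F + η v := by
      simp only [size, Finset.sum_insert hv]; ring
    have h2 : (η.size F + η v) ^ n ≤ 2 ^ n * (η.size F ^ n + η v ^ n) := by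
      rcases le_total (η.size F) (η v) with h | h
      · calc (η.size F + η v) ^ n ≤ (2 * η v) ^ n := Nat.pow_le_pow_left (by omega) n
          _ ≤ _ := by rw [mul_pow]; gcongr; omega
      · calc (η.size F + η v) ^ n ≤ (2 * η.size F) ^ n := Nat.pow_le_pow_left (by omega) n
          _ ≤ _ := by rw [mul_pow]; gcongr; omega
    rw [h1, Finset.sum_insert hv]
    refine h2.trans ?_
    rw [mul_assoc]
    gcongr
    have := hC η
    nlinarith [Nat.zero_le (C * η v ^ n), Nat.zero_le (∑ v ∈ F, η v ^ n)]

theorem Config.size_le_of_subset {Λ F : Finset V} (h : Λ ⊆ F) (η : Config V) :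
    η.size Λ ≤ η.size F :=
  Nat.add_le_add_left (Finset.sum_le_sum_of_subset h) 1

theorem Config.one_le_size (F : Finset V) (η : Config V) : 1 ≤ η.size F := Nat.le_add_right _ _

theorem Config.le_size {F : Finset V} {v : V} (hv : v ∈ F) (η : Config V) : η v ≤ η.size F :=
  (Finset.single_le_sum (f := η) (fun _ _ => Nat.zero_le _) hv).trans (Nat.le_add_left _ _)

theorem Config.size_move_le (Λ : Finset V) (η : Config V) (v w : V) :
    (η.move v w).size Λ ≤ (1 + Λ.card) * η.size Λ := by
  have h1 : ∑ u ∈ Λ, η.move v w u ≤ ∑ u ∈ Λ, (η u + 1) :=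
    Finset.sum_le_sum fun u _ => η.move_le v w u
  rw [Finset.sum_add_distrib, Finset.sum_const, smul_eq_mul, mul_one] at h1
  simp only [size]
  nlinarith [Nat.zero_le (Λ.card * ∑ u ∈ Λ, η u)]

namespace ParticleSystem

variable {A : ParticleSystem V}

theorem generator_dependsOnSites {f : Config V → ℝ} {Λ F : Finset V} (hf : DependsOnSites f Λ)
    (hF : A.Absorbs Λ F) : DependsOnSites (A.generator f) F := by
  intro η ζ hηζ
  rw [generator_eq_sum_of_cylinder hf hF, generator_eq_sum_of_cylinder hf hF]
  refine Finset.sum_congr rfl fun e he => ?_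
  rw [Finset.mem_product] at he
  have h1 := hηζ _ he.1
  have h2 := hηζ _ he.2
  have h3 : f η = f ζ := hf _ _ fun v hv => hηζ v (hF.1 hv)
  have h4 : f (η.move e.1 e.2) = f (ζ.move e.1 e.2) := by
    refine hf _ _ fun v hv => ?_
    have h5 := hηζ v (hF.1 hv)
    unfold Config.move
    rw [h1]
    split_ifs
    · exact h5
    · simp only [h5]
  simp only [jumpRate]
  rw [h1, h2, h3, h4]

/-- The jump rate is quadratic in the occupation numbers, hence the two extra powers. The constant
is chosen before f, so that it serves all cutoffs of a function simultaneously. -/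
theorem exists_generator_bound {Λ F : Finset V} (hF : A.Absorbs Λ F) {C : ℝ} (hC : 0 ≤ C)
    (n : ℕ) : ∃ C' : ℝ, 0 ≤ C' ∧ ∀ f, DependsOnSites f Λ →
      (∀ η, |f η| ≤ C * (η.size Λ : ℝ) ^ n) →
        ∀ η, |A.generator f η| ≤ C' * (η.size F : ℝ) ^ (n + 2) := by
  refine ⟨∑ e ∈ F ×ˢ F, |A.rate e.1 e.2| * (|A.α| + |A.s|) * (C * ((1 + Λ.card) ^ n + 1)),
    Finset.sum_nonneg fun e _ => by positivity, fun f hf hfC η => ?_⟩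
  rw [generator_eq_sum_of_cylinder hf hF, Finset.sum_mul]
  refine (Finset.abs_sum_le_sum_abs _ _).trans (Finset.sum_le_sum fun e he => ?_)
  rw [Finset.mem_product] at he
  set s : ℝ := (η.size F : ℝ) with hs
  have hs1 : 1 ≤ s := by
      rw [hs]; exact_mod_cast η.one_le_size F
  have hsΛ : (η.size Λ : ℝ) ≤ s := by
      rw [hs]; exact_mod_cast η.size_le_of_subset hF.1
  have h1 : |A.jumpRate η e| ≤ |A.rate e.1 e.2| * (|A.α| + |A.s|) * s ^ 2 := by
    have hv : (η e.1 : ℝ) ≤ s := by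
      rw [hs]; exact_mod_cast η.le_size he.1
    have hw : (η e.2 : ℝ) ≤ s := by
      rw [hs]; exact_mod_cast η.le_size he.2
    have h2 : |A.α + A.s * η e.2| ≤ (|A.α| + |A.s|) * s := by
      refine (abs_add_le _ _).trans ?_
      rw [abs_mul, Nat.abs_cast, add_mul]
      gcongr
      exact le_mul_of_one_le_right (abs_nonneg _) hs1
    rw [jumpRate, abs_mul, abs_mul, Nat.abs_cast]
    calc |A.rate e.1 e.2| * (η e.1 : ℝ) * |A.α + A.s * η e.2|
        ≤ |A.rate e.1 e.2| * s * ((|A.α| + |A.s|) * s) := by gcongr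
      _ = _ := by ring
  have h2 : |f (η.move e.1 e.2) - f η| ≤ C * ((1 + Λ.card) ^ n + 1) * s ^ n := by
    have h3 : |f (η.move e.1 e.2)| ≤ C * ((1 + Λ.card) * s) ^ n := by
      refine (hfC _).trans ?_
      have h4 : ((η.move e.1 e.2).size Λ : ℝ) ≤ (1 + Λ.card) * η.size Λ := by
        exact_mod_cast η.size_move_le Λ e.1 e.2
      gcongr
      exact h4.trans (by gcongr)
    have h4 : |f η| ≤ C * s ^ n := (hfC _).trans (by gcongr)
    rw [mul_pow] at h3
    calc |f (η.move e.1 e.2) - f η| ≤ |f (η.move e.1 e.2)| + |f η| := abs_sub _ _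
      _ ≤ C * ((1 + Λ.card) ^ n * s ^ n) + C * s ^ n := add_le_add h3 h4
      _ = _ := by ring
  rw [abs_mul]
  calc |A.jumpRate η e| * |f (η.move e.1 e.2) - f η|
      ≤ (|A.rate e.1 e.2| * (|A.α| + |A.s|) * s ^ 2) * (C * ((1 + Λ.card) ^ n + 1) * s ^ n) := by
        gcongr
    _ = _ := by ring

end ParticleSystem

/-- The function `f`, evaluated after cutting off all occupation numbers at `N`. -/
def cutoff (f : Config V → ℝ) (N : ℕ) (η : Config V) : ℝ := f fun v => min (η v) N

theorem cutoff_dependsOnSites {f : Config V → ℝ} {Λ : Finset V} (hf : DependsOnSites f Λ) (N : ℕ) :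
    DependsOnSites (cutoff f N) Λ :=
  fun η ζ h => hf _ _ fun v hv => by simp only [h v hv]

theorem abs_cutoff_le {f : Config V → ℝ} {Λ : Finset V} {C : ℝ} (hC : 0 ≤ C) {n : ℕ}
    (hf : ∀ η, |f η| ≤ C * (η.size Λ : ℝ) ^ n) (N : ℕ) (η : Config V) :
    |cutoff f N η| ≤ C * (η.size Λ : ℝ) ^ n := by
  refine (hf _).trans ?_
  have : Config.size Λ (fun v => min (η v) N) ≤ η.size Λ :=
    Nat.add_le_add_left (Finset.sum_le_sum fun v _ => min_le_left _ _) 1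
  gcongr

theorem cutoff_bounded {f : Config V → ℝ} {Λ : Finset V} {C : ℝ} (hC : 0 ≤ C) {n : ℕ}
    (hf : ∀ η, |f η| ≤ C * (η.size Λ : ℝ) ^ n) (N : ℕ) : ∃ K, ∀ η, |cutoff f N η| ≤ K := by
  refine ⟨C * ((1 + Λ.card * N : ℕ) : ℝ) ^ n, fun η => (hf _).trans ?_⟩
  have : Config.size Λ (fun v => min (η v) N) ≤ 1 + Λ.card * N := by
    refine Nat.add_le_add_left ?_ 1
    exact (Finset.sum_le_sum fun v _ => min_le_right _ _).trans (by simp)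
  gcongr

theorem cutoff_eq {f : Config V → ℝ} {Λ : Finset V} (hf : DependsOnSites f Λ) {N : ℕ}
    {η : Config V} (h : ∀ v ∈ Λ, η v ≤ N) : cutoff f N η = f η :=
  hf _ _ fun v hv => min_eq_left (h v hv)

theorem generator_cutoff_eq {A : ParticleSystem V} {f : Config V → ℝ} {Λ : Finset V}
    (hf : DependsOnSites f Λ) {N : ℕ} {η : Config V} (h : η.size Λ ≤ N) :
    A.generator (cutoff f N) η = A.generator f η := by
  -- The summand 1 in `Config.size` leaves room for the particle added by a move, so moved
  -- configurations are not cut off either.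
  have h1 : ∀ v ∈ Λ, η v + 1 ≤ N := by
    intro v hv
    have := Finset.single_le_sum (f := η) (fun _ _ => Nat.zero_le _) hv
    simp only [Config.size] at h
    omega
  refine finsum_congr fun e => ?_
  rw [cutoff_eq hf fun v hv => (Nat.le_succ _).trans (h1 v hv),
    cutoff_eq hf fun v hv => (η.move_le _ _ v).trans (h1 v hv)]

/-! ### Dynkin's formula -/

namespace ParticleSystem.IsProcessFrom

variable {A : ParticleSystem V} {η : Config V} {Ω : Type*} [MeasurableSpace Ω] {P : Measure Ω}
  {ℱ : Filtration ℝ≥0 ‹MeasurableSpace Ω›} {X : ℝ≥0 → Ω → Config V}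

theorem measurable_apply (hX : A.IsProcessFrom η P ℱ X) (t : ℝ≥0) : Measurable (X t) :=
  (hX.adapted t).mono (ℱ.le t) le_rfl

/-- Joint measurability, needed for Fubini, follows from right-continuity: time is replaced by grid
points τ n r > r decreasing the error to 0, and integer-valued coordinates are eventually equal to
their limit. -/
theorem measurable_comp (hX : A.IsProcessFrom η P ℱ X) {f : Config V → ℝ} {Λ : Finset V}
    (hf : DependsOnSites f Λ) : Measurable fun p : ℝ × Ω => f (X p.1.toNNReal p.2) := by
  set τ : ℕ → ℝ → ℝ := fun n r => ((⌊(n + 1 : ℝ) * r⌋ : ℝ) + 1) / (n + 1) with hτ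
  have hτlt : ∀ n r, r < τ n r := by
    intro n r
    rw [hτ, lt_div_iff₀ (by positivity), mul_comm]
    exact Int.lt_floor_add_one _
  have hτle : ∀ n r, τ n r ≤ r + 1 / (n + 1) := by
    intro n r
    have h0 : (0 : ℝ) < n + 1 := by positivity
    have h1 := Int.floor_le ((n + 1 : ℝ) * r)
    have h2 : (r + 1 / (n + 1 : ℝ)) * (n + 1) = (n + 1) * r + 1 := by field_simp
    rw [hτ, div_le_iff₀ h0, h2]
    linarith
  have hτlim : ∀ r, Tendsto (fun n => τ n r) atTop (𝓝 r) := by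
    intro r
    refine tendsto_of_tendsto_of_tendsto_of_le_of_le tendsto_const_nhds ?_
      (fun n => (hτlt n r).le) (fun n => hτle n r)
    simpa using (tendsto_one_div_add_atTop_nhds_zero_nat (𝕜 := ℝ)).const_add r
  refine measurable_of_tendsto_metrizable (f := fun n (p : ℝ × Ω) => f (X (τ n p.1).toNNReal p.2))
    ?_ ?_
  · intro n
    have h1 : Measurable fun q : ℤ × Ω => f (X (((q.1 : ℝ) + 1) / (n + 1)).toNNReal q.2) :=
      measurable_from_prod_countable_right fun k => 
        hf.measurable.comp (hX.measurable_apply (((k : ℝ) + 1) / (n + 1)).toNNReal)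
    exact h1.comp (((Int.measurable_floor.comp (measurable_fst.const_mul _))).prodMk measurable_snd)
  · rw [tendsto_pi_nhds]
    rintro ⟨r, ω⟩
    refine tendsto_const_nhds.congr' ?_
    have hev : ∀ v ∈ Λ, ∀ᶠ n in atTop, X (τ n r).toNNReal ω v = X r.toNNReal ω v := by
      intro v _
      have h1 : Tendsto (fun n => (τ n r).toNNReal) atTop (𝓝[≥] r.toNNReal) := by
        refine tendsto_nhdsWithin_iff.2 ⟨(continuous_real_toNNReal.tendsto r).comp (hτlim r), ?_⟩
        exact Eventually.of_forall fun n => Real.toNNReal_le_toNNReal (hτlt n r).le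
      have h2 := (hX.rightContinuous ω v r.toNNReal).tendsto.comp h1
      rw [nhds_discrete, tendsto_pure] at h2
      exact h2
    filter_upwards [(Filter.eventually_all_finset Λ).2 hev] with n hn
    exact (hf _ _ hn).symm

theorem size_moments (hX : A.IsProcessFrom η P ℱ X) (T : ℝ≥0) (F : Finset V) (n : ℕ) :
    ∃ K : ℝ≥0, ∀ t ≤ T, ∫⁻ ω, ((X t ω).size F : ℝ≥0∞) ^ n ∂P ≤ K := by
  have := hX.isProbabilityMeasure
  obtain ⟨C, hC⟩ := Config.size_pow_le F n
  choose K hK using fun v => hX.moments T v n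
  refine ⟨C * (1 + ∑ v ∈ F, K v), fun t ht => ?_⟩
  have hm : ∀ v, Measurable fun ω => (X t ω v : ℝ≥0∞) ^ n := fun v =>
    (Measurable.of_discrete (f := fun k : ℕ => (k : ℝ≥0∞) ^ n)).comp
      ((measurable_pi_apply v).comp (hX.measurable_apply t))
  calc ∫⁻ ω, ((X t ω).size F : ℝ≥0∞) ^ n ∂P
      ≤ ∫⁻ ω, C * (1 + ∑ v ∈ F, (X t ω v : ℝ≥0∞) ^ n) ∂P := by
        refine lintegral_mono fun ω => ?_
        have := Nat.mono_cast (α := ℝ≥0∞) (hC (X t ω))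
        push_cast at this
        exact this
    _ = C * (1 + ∑ v ∈ F, ∫⁻ ω, (X t ω v : ℝ≥0∞) ^ n ∂P) := by
        rw [lintegral_const_mul _ (by fun_prop), lintegral_add_left measurable_const,
          lintegral_finsetSum _ fun v _ => hm v]
        simp
    _ ≤ C * (1 + ∑ v ∈ F, (K v : ℝ≥0∞)) := by
        gcongr with v _
        exact hK v t ht
    _ = _ := by push_cast; rfl

theorem integrable_size_pow (hX : A.IsProcessFrom η P ℱ X) (t : ℝ≥0) (F : Finset V) (n : ℕ) :
    Integrable (fun ω => ((X t ω).size F : ℝ) ^ n) P := by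
  obtain ⟨K, hK⟩ := hX.size_moments t F n
  have hm : Measurable fun η : Config V => ((η.size F : ℝ)) ^ n := by
    refine DependsOnSites.measurable (Λ := F) fun η ζ h => ?_
    simp only [Config.size, Finset.sum_congr rfl h]
  refine ⟨(hm.comp (hX.measurable_apply t)).aestronglyMeasurable, ?_⟩
  refine lt_of_le_of_lt (le_trans (lintegral_mono fun ω => ?_) (hK t le_rfl)) ENNReal.coe_lt_top
  rw [enorm_pow, Real.enorm_natCast]

theorem integral_size_pow_le (hX : A.IsProcessFrom η P ℱ X) (T : ℝ≥0) (F : Finset V) (n : ℕ) :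
    ∃ K : ℝ, 0 ≤ K ∧ ∀ t ≤ T, ∫ ω, ((X t ω).size F : ℝ) ^ n ∂P ≤ K := by
  obtain ⟨K, hK⟩ := hX.size_moments T F n
  refine ⟨K, K.2, fun t ht => ?_⟩
  rw [integral_eq_lintegral_of_nonneg_ae (Eventually.of_forall fun ω => by positivity)
    (hX.integrable_size_pow t F n).aestronglyMeasurable]
  refine ENNReal.toReal_le_of_le_ofReal K.2 ?_
  rw [ENNReal.ofReal_coe_nnreal]
  refine le_trans (lintegral_mono fun ω => ?_) (hK t ht)
  rw [ENNReal.ofReal_pow (Nat.cast_nonneg _), ENNReal.ofReal_natCast]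

section growth

variable {f : Config V → ℝ} {Λ : Finset V} {C : ℝ} {n : ℕ}

theorem integrable_of_growth (hX : A.IsProcessFrom η P ℱ X) (hf : DependsOnSites f Λ)
    (hC : ∀ η, |f η| ≤ C * (η.size Λ : ℝ) ^ n) (t : ℝ≥0) : Integrable (fun ω => f (X t ω)) P :=
  ((hX.integrable_size_pow t Λ n).const_mul C).mono'
    (hf.measurable.comp (hX.measurable_apply t)).aestronglyMeasurable
    (Eventually.of_forall fun ω => hC (X t ω))

theorem abs_integral_le_of_growth (hX : A.IsProcessFrom η P ℱ X)
    (hC0 : 0 ≤ C) (hC : ∀ η, |f η| ≤ C * (η.size Λ : ℝ) ^ n) (T : ℝ≥0) :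
    ∃ K : ℝ, 0 ≤ K ∧ ∀ t ≤ T, ∫ ω, |f (X t ω)| ∂P ≤ K := by
  obtain ⟨K, hK0, hK⟩ := hX.integral_size_pow_le T Λ n
  refine ⟨C * K, mul_nonneg hC0 hK0, fun t ht => ?_⟩
  calc ∫ ω, |f (X t ω)| ∂P ≤ ∫ ω, C * ((X t ω).size Λ : ℝ) ^ n ∂P :=
        integral_mono_of_nonneg (Eventually.of_forall fun ω => abs_nonneg _)
          ((hX.integrable_size_pow t Λ n).const_mul C) (Eventually.of_forall fun ω => hC _)
    _ = C * ∫ ω, ((X t ω).size Λ : ℝ) ^ n ∂P := integral_const_mul _ _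
    _ ≤ C * K := by gcongr; exact hK t ht

theorem stronglyMeasurable_integral (hX : A.IsProcessFrom η P ℱ X) (hf : DependsOnSites f Λ) :
    StronglyMeasurable fun r : ℝ => ∫ ω, f (X r.toNNReal ω) ∂P := by
  have := hX.isProbabilityMeasure
  exact StronglyMeasurable.integral_prod_right (hX.measurable_comp hf).stronglyMeasurable

theorem integrable_prod_of_growth (hX : A.IsProcessFrom η P ℱ X) (hf : DependsOnSites f Λ)
    (hC0 : 0 ≤ C) (hC : ∀ η, |f η| ≤ C * (η.size Λ : ℝ) ^ n) (t : ℝ≥0) :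
    Integrable (fun p : ℝ × Ω => f (X p.1.toNNReal p.2))
      ((volume.restrict (Set.Ioc (0 : ℝ) t)).prod P) := by
  have := hX.isProbabilityMeasure
  obtain ⟨K, hK0, hK⟩ := hX.abs_integral_le_of_growth hC0 hC t
  rw [integrable_prod_iff (hX.measurable_comp hf).aestronglyMeasurable]
  refine ⟨Eventually.of_forall fun r => hX.integrable_of_growth hf hC r.toNNReal, ?_⟩
  refine Measure.integrableOn_of_bounded (M := K) (by simp) ?_ ?_
  · exact (StronglyMeasurable.integral_prod_right
      (hX.measurable_comp hf).stronglyMeasurable.norm).aestronglyMeasurable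
  · filter_upwards [ae_restrict_mem measurableSet_Ioc] with r hr
    rw [Real.norm_of_nonneg (integral_nonneg fun ω => norm_nonneg _)]
    exact hK _ (Real.toNNReal_le_iff_le_coe.2 hr.2)

theorem integral_start (hX : A.IsProcessFrom η P ℱ X) (f : Config V → ℝ) :
    ∫ ω, f (X 0 ω) ∂P = f η := by
  have := hX.isProbabilityMeasure
  rw [integral_congr_ae (g := fun _ => f η) (hX.start.mono fun ω hω => by simp only [hω])]
  simp

/-- The martingale has constant expectation, equal to its value 0 at time 0. Since the generator of
a bounded function need not be bounded, Fubini relies on the moment bounds. -/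
theorem dynkin_of_bounded (hX : A.IsProcessFrom η P ℱ X) {F : Finset V} (hF : A.Absorbs Λ F)
    (hf : DependsOnSites f Λ) (hbd : ∃ K, ∀ η, |f η| ≤ K) (t : ℝ≥0) :
    ∫ ω, f (X t ω) ∂P
      = f η + ∫ r in (0 : ℝ)..t, ∫ ω, A.generator f (X r.toNNReal ω) ∂P := by
  have := hX.isProbabilityMeasure
  obtain ⟨K, hK⟩ := hbd
  have hK0 : 0 ≤ K := (abs_nonneg _).trans (hK 0)
  have hgrow : ∀ η, |f η| ≤ K * (η.size Λ : ℝ) ^ 0 := by simpa using hK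
  obtain ⟨C', hC'0, hC'⟩ := ParticleSystem.exists_generator_bound hF hK0 0
  have hprod := hX.integrable_prod_of_growth (ParticleSystem.generator_dependsOnSites hf hF) hC'0
    (hC' f hf hgrow) t
  have hI : Integrable (fun ω => ∫ r in (0 : ℝ)..t, A.generator f (X r.toNNReal ω)) P := by
    simp_rw [intervalIntegral.integral_of_le t.coe_nonneg]
    exact hprod.integral_prod_right
  have hswap : ∫ ω, (∫ r in (0 : ℝ)..t, A.generator f (X r.toNNReal ω)) ∂P
      = ∫ r in (0 : ℝ)..t, ∫ ω, A.generator f (X r.toNNReal ω) ∂P := by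
    simp_rw [intervalIntegral.integral_of_le t.coe_nonneg]
    have := integral_integral_swap (f := fun (r : ℝ) ω => A.generator f (X r.toNNReal ω))
      (μ := volume.restrict (Set.Ioc (0 : ℝ) t)) (ν := P) hprod
    exact this.symm
  have hmart := (hX.martingale f ⟨Λ, hf⟩ ⟨K, hK⟩).setIntegral_eq (zero_le : 0 ≤ t)
    (MeasurableSet.univ)
  simp only [Measure.restrict_univ, sub_self, NNReal.coe_zero, intervalIntegral.integral_same,
    integral_zero] at hmart
  have hsub : Integrable (fun ω => f (X t ω) - f (X 0 ω)) P :=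
    (hX.integrable_of_growth hf hgrow t).sub (hX.integrable_of_growth hf hgrow 0)
  rw [integral_sub hsub hI, integral_sub (hX.integrable_of_growth hf hgrow t) (hX.integrable_of_growth hf hgrow 0),
    hswap, hX.integral_start] at hmart
  linarith

theorem intervalIntegrable_integral (hX : A.IsProcessFrom η P ℱ X) (hf : DependsOnSites f Λ)
    (hC0 : 0 ≤ C) (hC : ∀ η, |f η| ≤ C * (η.size Λ : ℝ) ^ n) (a b : ℝ) :
    IntervalIntegrable (fun r : ℝ => ∫ ω, f (X r.toNNReal ω) ∂P) volume a b := by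
  obtain ⟨K, hK0, hK⟩ := hX.abs_integral_le_of_growth hC0 hC (max a b).toNNReal
  refine (intervalIntegrable_const (c := K)).mono_fun'
    (hX.stronglyMeasurable_integral hf).aestronglyMeasurable ?_
  filter_upwards [ae_restrict_mem measurableSet_uIoc] with r hr
  refine (norm_integral_le_integral_norm _).trans (hK _ (Real.toNNReal_le_toNNReal ?_))
  exact hr.2

/-- Dynkin's formula for cylinder functions of polynomial growth. -/
theorem dynkin (hX : A.IsProcessFrom η P ℱ X) {F : Finset V} (hF : A.Absorbs Λ F)
    (hf : DependsOnSites f Λ) (hC0 : 0 ≤ C) (hC : ∀ η, |f η| ≤ C * (η.size Λ : ℝ) ^ n) (t : ℝ≥0) :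
    ∫ ω, f (X t ω) ∂P
      = f η + ∫ r in (0 : ℝ)..t, ∫ ω, A.generator f (X r.toNNReal ω) ∂P := by
  obtain ⟨C', hC'0, hC'⟩ := ParticleSystem.exists_generator_bound hF hC0 n
  obtain ⟨K, hK0, hK⟩ := hX.integral_size_pow_le t F (n + 2)
  have hcut := fun N => cutoff_dependsOnSites hf N
  have hcutC := fun N => abs_cutoff_le hC0 hC N
  have hev : ∀ ζ : Config V, ∀ᶠ N in atTop, ζ.size Λ ≤ N := fun ζ => eventually_ge_atTop _
  -- Every term of the formula for the cutoffs converges by dominated convergence; the dominating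
  -- polynomials in the size do not depend on N.
  have l1 : Tendsto (fun N => ∫ ω, cutoff f N (X t ω) ∂P) atTop (𝓝 (∫ ω, f (X t ω) ∂P)) := by
    refine tendsto_integral_of_dominated_convergence (fun ω => C * ((X t ω).size Λ : ℝ) ^ n)
      (fun N => ((hcut N).measurable.comp (hX.measurable_apply t)).aestronglyMeasurable)
      ((hX.integrable_size_pow t Λ n).const_mul C)
      (fun N => Eventually.of_forall fun ω => hcutC N _) (Eventually.of_forall fun ω => ?_)
    refine tendsto_const_nhds.congr' ?_
    filter_upwards [hev (X t ω)] with N hN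
    exact (cutoff_eq hf fun v hv => (Config.le_size hv _).trans hN).symm
  have l2 : ∀ r : ℝ, Tendsto (fun N => ∫ ω, A.generator (cutoff f N) (X r.toNNReal ω) ∂P) atTop
      (𝓝 (∫ ω, A.generator f (X r.toNNReal ω) ∂P)) := by
    intro r
    refine tendsto_integral_of_dominated_convergence
      (fun ω => C' * ((X r.toNNReal ω).size F : ℝ) ^ (n + 2))
      (fun N => ((ParticleSystem.generator_dependsOnSites (hcut N) hF).measurable.comp
        (hX.measurable_apply _)).aestronglyMeasurable)
      ((hX.integrable_size_pow _ F (n + 2)).const_mul C')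
      (fun N => Eventually.of_forall fun ω => hC' _ (hcut N) (hcutC N) _)
      (Eventually.of_forall fun ω => ?_)
    refine tendsto_const_nhds.congr' ?_
    filter_upwards [hev (X r.toNNReal ω)] with N hN
    exact (generator_cutoff_eq hf hN).symm
  have l3 : Tendsto (fun N => ∫ r in (0 : ℝ)..t,
      ∫ ω, A.generator (cutoff f N) (X r.toNNReal ω) ∂P) atTop
      (𝓝 (∫ r in (0 : ℝ)..t, ∫ ω, A.generator f (X r.toNNReal ω) ∂P)) := by
    refine intervalIntegral.tendsto_integral_filter_of_dominated_convergence (fun _ => C' * K)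
      (Eventually.of_forall fun N => (hX.stronglyMeasurable_integral
        (ParticleSystem.generator_dependsOnSites (hcut N) hF)).aestronglyMeasurable)
      (Eventually.of_forall fun N => Eventually.of_forall fun r hr => ?_)
      intervalIntegrable_const (Eventually.of_forall fun r _ => l2 r)
    rw [Set.uIoc_of_le t.coe_nonneg] at hr
    calc ‖∫ ω, A.generator (cutoff f N) (X r.toNNReal ω) ∂P‖
        ≤ ∫ ω, C' * ((X r.toNNReal ω).size F : ℝ) ^ (n + 2) ∂P :=
          norm_integral_le_of_norm_le ((hX.integrable_size_pow _ F (n + 2)).const_mul C')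
            (Eventually.of_forall fun ω => hC' _ (hcut N) (hcutC N) _)
      _ = C' * ∫ ω, ((X r.toNNReal ω).size F : ℝ) ^ (n + 2) ∂P := integral_const_mul _ _
      _ ≤ C' * K := by
          gcongr
          exact hK _ (Real.toNNReal_le_iff_le_coe.2 hr.2)
  have l4 : Tendsto (fun N => cutoff f N η) atTop (𝓝 (f η)) := by
    refine tendsto_const_nhds.congr' ?_
    filter_upwards [hev η] with N hN
    exact (cutoff_eq hf fun v hv => (Config.le_size hv _).trans hN).symm
  refine tendsto_nhds_unique l1 ((l4.add l3).congr fun N => ?_)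
  exact (hX.dynkin_of_bounded hF (hcut N) (cutoff_bounded hC0 hC N) t).symm

end growth

end ParticleSystem.IsProcessFrom

end

section

/-! ### Expectations of the duality function -/

variable {V : Type*}

theorem fallingDual_dependsOnSites {β : ℕ → ℝ} (h0 : β 0 = 1) {ζ : Config V}
    (hζ : ζ.IsFinite) : DependsOnSites (fallingDual β ζ) hζ.sites :=
  fun _ _ => fallingDual_congr h0 fun v hv => by simpa using hv

theorem exists_fallingDual_bound {β : ℕ → ℝ} (h0 : β 0 = 1) (hβ : ∀ k, 0 < β k) {ζ : Config V}
    (hζ : ζ.IsFinite) : ∃ C : ℝ, 0 ≤ C ∧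
      ∀ η : Config V, |fallingDual β ζ η| ≤ C * (η.size hζ.sites : ℝ) ^ ζ.total := by
  have hs : ∀ v, ζ v ≠ 0 → v ∈ hζ.sites := fun v hv => by simpa using hv
  refine ⟨∏ v ∈ hζ.sites, β (ζ v), Finset.prod_nonneg fun v _ => (hβ _).le, fun η => ?_⟩
  rw [abs_of_nonneg (fallingDual_nonneg hβ _ _), fallingDual_eq_prod h0 hs,
    Finset.prod_mul_distrib, Config.total_eq_sum hs, ← Finset.prod_pow_eq_pow_sum]
  refine mul_le_mul_of_nonneg_left ?_ (Finset.prod_nonneg fun v _ => (hβ _).le)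
  refine Finset.prod_le_prod (fun v _ => Nat.cast_nonneg _) fun v hv => ?_
  exact_mod_cast (Nat.descFactorial_le_pow _ _).trans (Nat.pow_le_pow_left (η.le_size hv) _)

/-- The expectation of the duality function, as a function of time and the dual configuration. -/
def dualMean {Ω : Type*} [MeasurableSpace Ω] (β : ℕ → ℝ) (P : Measure Ω) (X : ℝ≥0 → Ω → Config V)
    (t : ℝ) (ζ : Config V) : ℝ :=
  ∫ ω, fallingDual β ζ (X t.toNNReal ω) ∂P

namespace DualityPair

variable {A B : ParticleSystem V} {ok : ℕ → Prop} {β : ℕ → ℝ}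

section evolution

variable {η : Config V} {Ω : Type*} [MeasurableSpace Ω] {P : Measure Ω}
  {ℱ : Filtration ℝ≥0 ‹MeasurableSpace Ω›} {X : ℝ≥0 → Ω → Config V}

theorem integrable_fallingDual (h : DualityPair A B ok β) (hX : A.IsProcessFrom η P ℱ X)
    {ζ : Config V} (hζ : ζ.IsFinite) (t : ℝ≥0) :
    Integrable (fun ω => fallingDual β ζ (X t ω)) P := by
  obtain ⟨C, -, hC⟩ := exists_fallingDual_bound h.weight_zero h.weight_pos hζ
  exact hX.integrable_of_growth (fallingDual_dependsOnSites h.weight_zero hζ) hC t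

theorem ok_of_mem_process (h : DualityPair A B ok β) (hX : A.IsProcessFrom η P ℱ X) (t : ℝ≥0)
    (ω : Ω) (v : V) : ok (X t ω v) := by
  have := hX.mem_space t ω
  rw [h.space_left] at this
  exact this v

/-- After generator duality the operator acts on ζ, where it is a finite sum with deterministic
coefficients and commutes with the expectation. This closes the evolution equation. -/
theorem integral_generator (h : DualityPair A B ok β) (hX : A.IsProcessFrom η P ℱ X)
    {ζ : Config V} (hζ : ζ.IsFinite) (hok : ∀ v, ok (ζ v)) (r : ℝ) :
    ∫ ω, A.generator (fallingDual β ζ) (X r.toNNReal ω) ∂P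
      = B.generator (dualMean β P X r) ζ := by
  have hs : ∀ v, ζ v ≠ 0 → v ∈ hζ.sites := fun v hv => by simpa using hv
  obtain ⟨F, hF⟩ := ParticleSystem.exists_absorbs h.symm.finite_range hζ.sites
  simp_rw [fun ω => h.generator_duality hζ hok (h.ok_of_mem_process hX r.toNNReal ω),
    ParticleSystem.generator_eq_sum_of_finite hs hF]
  have hint : ∀ x : Config V, x.IsFinite →
      Integrable (fun ω => fallingDual β x (X r.toNNReal ω)) P :=
    fun x hx => h.integrable_fallingDual hX hx _
  have hmv : ∀ e : V × V, (ζ.move e.1 e.2).IsFinite := fun e => (Config.total_move hζ _ _).1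
  have hdiff : ∀ e : V × V, Integrable (fun ω => B.jumpRate ζ e *
      (fallingDual β (ζ.move e.1 e.2) (X r.toNNReal ω) - fallingDual β ζ (X r.toNNReal ω))) P :=
    fun e => ((hint _ (hmv e)).sub (hint _ hζ)).const_mul _
  rw [integral_finsetSum _ fun e _ => hdiff e]
  refine Finset.sum_congr rfl fun e _ => ?_
  rw [integral_const_mul, integral_sub (hint _ (hmv e)) (hint _ hζ)]
  rfl

theorem dualMean_eq (h : DualityPair A B ok β) (hX : A.IsProcessFrom η P ℱ X)
    {ζ : Config V} (hζ : ζ.IsFinite) (hok : ∀ v, ok (ζ v)) {t : ℝ} (ht : 0 ≤ t) :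
    dualMean β P X t ζ
      = fallingDual β ζ η + ∫ r in (0 : ℝ)..t, B.generator (dualMean β P X r) ζ := by
  obtain ⟨F, hF⟩ := ParticleSystem.exists_absorbs h.finite_range hζ.sites
  obtain ⟨C, hC0, hC⟩ := exists_fallingDual_bound h.weight_zero h.weight_pos hζ
  have := hX.dynkin hF (fallingDual_dependsOnSites h.weight_zero hζ) hC0 hC t.toNNReal
  rw [Real.coe_toNNReal _ ht] at this
  simp_rw [h.integral_generator hX hζ hok] at this
  exact this

theorem intervalIntegrable_generator_dualMean (h : DualityPair A B ok β)
    (hX : A.IsProcessFrom η P ℱ X) {ζ : Config V} (hζ : ζ.IsFinite) (hok : ∀ v, ok (ζ v)) :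
    StronglyMeasurable (fun r => B.generator (dualMean β P X r) ζ) ∧
    ∀ a b : ℝ, IntervalIntegrable (fun r => B.generator (dualMean β P X r) ζ) volume a b := by
  obtain ⟨F, hF⟩ := ParticleSystem.exists_absorbs h.finite_range hζ.sites
  obtain ⟨C, hC0, hC⟩ := exists_fallingDual_bound h.weight_zero h.weight_pos hζ
  have hdep := fallingDual_dependsOnSites h.weight_zero hζ
  obtain ⟨C', hC'0, hC'⟩ := ParticleSystem.exists_generator_bound hF hC0 ζ.total
  have hgen := ParticleSystem.generator_dependsOnSites hdep hF
  simp_rw [← h.integral_generator hX hζ hok]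
  exact ⟨hX.stronglyMeasurable_integral hgen,
    hX.intervalIntegrable_integral hgen hC'0 (hC' _ hdep hC)⟩

theorem continuousOn_dualMean (h : DualityPair A B ok β) (hX : A.IsProcessFrom η P ℱ X)
    {ζ : Config V} (hζ : ζ.IsFinite) (hok : ∀ v, ok (ζ v)) :
    ContinuousOn (fun t => dualMean β P X t ζ) (Set.Ici 0) := by
  have := (intervalIntegral.continuous_primitive
    (h.intervalIntegrable_generator_dualMean hX hζ hok).2 0).const_add (fallingDual β ζ η)
  exact this.continuousOn.congr fun t ht => h.dualMean_eq hX hζ hok ht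

theorem hasSum_dualMean (h : DualityPair A B ok β) (hX : A.IsProcessFrom η P ℱ X) {k : ℕ} {Λ : ℝ}
    (hB : IsKernelOn (Option (V × V)) (B.shiftedGenerator Λ) (levelSet V ok k)) {t : ℝ}
    (ht : 0 ≤ t) {ζ : Config V} (hζ : ζ ∈ levelSet V ok k) :
    HasSum (fun n => t ^ n / n ! * (B.shiftedGenerator Λ)^[n] (fun x => fallingDual β x η) ζ)
      (Real.exp (Λ * t) * dualMean β P X t ζ) := by
  have h0 : dualMean β P X 0 = fun x => fallingDual β x η := by
    ext x
    simp only [dualMean, Real.toNNReal_zero]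
    exact hX.integral_start _
  have hcont : ∀ x ∈ levelSet V ok k, ContinuousOn (fun t => dualMean β P X t x) (Set.Ici 0) :=
    fun x hx => h.continuousOn_dualMean hX hx.1 hx.2.1
  rw [← h0]
  refine hB.hasSum_of_evolution Λ hcont
    (fun t _ x _ => integral_nonneg fun ω => fallingDual_nonneg h.weight_pos _ _) ?_ ht hζ
  intro t ht x hx
  obtain ⟨hm, hi⟩ := h.intervalIntegrable_generator_dualMean hX hx.1 hx.2.1
  -- Rows are finite, so continuity of the means at each configuration carries over to the
  -- integrand, and the integral equation can be differentiated.
  have hgc : ContinuousAt (fun r => B.generator (dualMean β P X r) x) t := by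
    have h1 := (hB.continuousOn_iterate hcont 1 x hx).sub ((hcont x hx).const_mul Λ)
    refine (h1.congr fun r _ => ?_).continuousAt (Ici_mem_nhds ht)
    simp [ParticleSystem.shiftedGenerator]
  have hd := (intervalIntegral.integral_hasDerivAt_right (hi 0 t)
    hm.stronglyMeasurableAtFilter hgc).const_add (fallingDual β x η)
  refine (hd.congr_of_eventuallyEq ?_).congr_deriv ?_
  · filter_upwards [Ioi_mem_nhds ht] with r hr
    exact h.dualMean_eq hX hx.1 hx.2.1 (le_of_lt hr)
  · simp [ParticleSystem.shiftedGenerator]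

end evolution

/-! ### The law of the dual process -/

section law

variable {ξ : Config V} {Ω : Type*} [MeasurableSpace Ω] {Q : Measure Ω}
  {𝒢 : Filtration ℝ≥0 ‹MeasurableSpace Ω›} {Y : ℝ≥0 → Ω → Config V}

/-- No configuration with |ξ|+1 particles lies below ξ, so the initial data vanish on this whole
level and the exponential series is zero. A nonnegative variable with mean zero vanishes almost
surely. -/
theorem ae_not_le (h : DualityPair A B ok β) (hY : B.IsProcessFrom ξ Q 𝒢 Y) (hξ : ξ.IsFinite)
    (t : ℝ≥0) {ζ : Config V} (hζ : ζ ∈ levelSet V ok (ξ.total + 1)) :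
    ∀ᵐ ω ∂Q, ¬ ζ ≤ Y t ω := by
  obtain ⟨Λ, hΛ, -⟩ := h.exists_isKernelOn_pair (ξ.total + 1)
  have hzero : ∀ x ∈ levelSet V ok (ξ.total + 1), fallingDual β x ξ = 0 := by
    intro x hx
    refine fallingDual_eq_zero h.weight_zero h.weight_pos hx.1 fun hle => ?_
    have hx' := hx.2.2
    rw [Config.eq_of_le_of_total_le hle hξ (by omega)] at hx'
    omega
  have hit : ∀ n, (A.shiftedGenerator Λ)^[n] (fun x => fallingDual β x ξ) ζ = 0 := by
    intro n
    rw [hΛ.iterate_congr (g := fun x => 0 * 0) (fun x hx => by rw [hzero x hx, zero_mul]) n ζ hζ,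
      hΛ.iterate_const_mul 0 (fun _ => 0) n hζ, zero_mul]
  have hsum := h.symm.hasSum_dualMean hY hΛ t.coe_nonneg hζ
  simp_rw [hit, mul_zero] at hsum
  have hmean : dualMean β Q Y t ζ = 0 := by
    have := hsum.unique hasSum_zero
    simpa [(Real.exp_pos _).ne'] using this
  rw [dualMean, Real.toNNReal_coe, integral_eq_zero_iff_of_nonneg
    (fun ω => fallingDual_nonneg h.weight_pos _ _) (h.symm.integrable_fallingDual hY hζ.1 t)]
    at hmean
  filter_upwards [hmean] with ω hω hle
  exact ((fallingDual_pos_iff h.weight_zero h.weight_pos hζ.1 _).2 hle).ne' hω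

theorem countable_levelSet [Countable V] (k : ℕ) : (levelSet V ok k).Countable :=
  Config.countable_isFinite.mono fun _ h => h.1

/-- A configuration with too many, possibly infinitely many, particles dominates one with exactly
|ξ|+1, and there are only countably many of these to exclude. -/
theorem ae_isFinite [Countable V] (h : DualityPair A B ok β) (hY : B.IsProcessFrom ξ Q 𝒢 Y)
    (hξ : ξ.IsFinite) (t : ℝ≥0) :
    ∀ᵐ ω ∂Q, (Y t ω).IsFinite ∧ (Y t ω).total ≤ ξ.total := by
  have hall := (ae_ball_iff (countable_levelSet (ok := ok) (ξ.total + 1))).2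
    fun ζ hζ => h.ae_not_le hY hξ t hζ
  filter_upwards [hall] with ω hω
  by_contra hcon
  obtain ⟨ζ, hle, hfin, htot⟩ := (Y t ω).exists_le_total_eq hcon _ le_rfl
  exact hω ζ ⟨hfin, fun v => h.ok_of_le (h.symm.ok_of_mem_process hY t ω v) (hle v), htot⟩ hle

open Classical in
/-- The law of the dual process on configurations with the initial number of particles. -/
theorem hasSum_law [Countable V] (h : DualityPair A B ok β) (hY : B.IsProcessFrom ξ Q 𝒢 Y)
    (hξ : ξ ∈ levelSet V ok ξ.total) {Λ : ℝ}
    (hA : IsKernelOn (Option (V × V)) (A.shiftedGenerator Λ) (levelSet V ok ξ.total))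
    (hB : IsKernelOn (Option (V × V)) (B.shiftedGenerator Λ) (levelSet V ok ξ.total))
    (t : ℝ≥0) {ζ : Config V} (hζ : ζ ∈ levelSet V ok ξ.total) :
    HasSum (fun n => (t : ℝ) ^ n / n ! *
        (B.shiftedGenerator Λ)^[n] (fun x => if x = ζ then 1 else 0) ξ)
      (Real.exp (Λ * t) * (Q.map (Y t)).real {ζ}) := by
  set D := fallingDual β ζ ζ with hD
  have hD0 : D ≠ 0 := ((fallingDual_pos_iff h.weight_zero h.weight_pos hζ.1 ζ).2 le_rfl).ne'
  have hdiag : ∀ x : Config V, x.IsFinite ∧ x.total ≤ ξ.total →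
      fallingDual β ζ x = D * if x = ζ then 1 else 0 := by
    rintro x ⟨hx, hxt⟩
    by_cases hxz : x = ζ
    · simp [hxz, hD]
    · rw [if_neg hxz, mul_zero]
      refine fallingDual_eq_zero h.weight_zero h.weight_pos hζ.1 fun hle => hxz ?_
      exact (Config.eq_of_le_of_total_le hle hx (hxt.trans_eq hζ.2.2.symm)).symm
  have hmean : dualMean β Q Y t ζ = D * (Q.map (Y t)).real {ζ} := by
    rw [dualMean, Real.toNNReal_coe,
      integral_congr_ae ((h.ae_isFinite hY hξ.1 t).mono fun ω hω => hdiag _ hω),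
      integral_const_mul, map_measureReal_apply (hY.measurable_apply t) (measurableSet_singleton _),
      ← integral_indicator_one (hY.measurable_apply t (measurableSet_singleton _))]
    congr 2
  -- Exchanging the systems in the series put powers of the `A`-operator on ζ; duality moves them
  -- back to powers of the `B`-operator at ξ.
  have hit : ∀ n, (A.shiftedGenerator Λ)^[n] (fun x => fallingDual β x ξ) ζ
      = D * (B.shiftedGenerator Λ)^[n] (fun x => if x = ζ then 1 else 0) ξ := by
    intro n
    rw [h.iterate_duality hA hB n ζ hζ ξ hξ,
      hB.iterate_congr (fun x hx => hdiag x ⟨hx.1, hx.2.2.le⟩) n ξ hξ,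
      hB.iterate_const_mul D _ n hξ]
  have hsum := (h.symm.hasSum_dualMean hY hA t.coe_nonneg hζ).mul_left D⁻¹
  rw [hmean] at hsum
  simp_rw [hit] at hsum
  have hval : Real.exp (Λ * t) * (Q.map (Y t)).real {ζ}
      = D⁻¹ * (Real.exp (Λ * t) * (D * (Q.map (Y t)).real {ζ})) := by field_simp
  rw [hval]
  refine hsum.congr_fun fun n => ?_
  field_simp

/-- Tonelli for the double series over n and ζ. Extended nonnegative values allow an unbounded f
without prior integrability. -/
theorem tsum_law [Countable V] (h : DualityPair A B ok β) (hY : B.IsProcessFrom ξ Q 𝒢 Y)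
    (hξ : ξ ∈ levelSet V ok ξ.total) {Λ : ℝ}
    (hA : IsKernelOn (Option (V × V)) (A.shiftedGenerator Λ) (levelSet V ok ξ.total))
    (hB : IsKernelOn (Option (V × V)) (B.shiftedGenerator Λ) (levelSet V ok ξ.total))
    (t : ℝ≥0) {f : Config V → ℝ} (hf : ∀ x ∈ levelSet V ok ξ.total, 0 ≤ f x) {a : ℝ}
    (ha : HasSum (fun n => (t : ℝ) ^ n / n ! * (B.shiftedGenerator Λ)^[n] f ξ)
      (Real.exp (Λ * t) * a)) :
    ∑' ζ : levelSet V ok ξ.total, ENNReal.ofReal (f ζ) * (Q.map (Y t)) {(ζ : Config V)}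
      = ENNReal.ofReal a := by
  classical
  have := hY.isProbabilityMeasure
  have := Measure.isProbabilityMeasure_map (μ := Q) (hY.measurable_apply t).aemeasurable
  set E := Real.exp (Λ * t) with hE
  have hE0 : 0 < E := Real.exp_pos _
  set p : ℕ → Config V → ℝ := fun n ζ =>
    (B.shiftedGenerator Λ)^[n] (fun x => if x = ζ then 1 else 0) ξ with hp
  have hp0 : ∀ n ζ, 0 ≤ p n ζ := fun n ζ =>
    hB.iterate_nonneg (fun x _ => by split_ifs <;> norm_num) n ξ hξ
  have hnn : ∀ n (ζ : levelSet V ok ξ.total), 0 ≤ (t : ℝ) ^ n / n ! * (f ζ * p n ζ) := fun n ζ =>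
    mul_nonneg (by positivity) (mul_nonneg (hf ζ ζ.2) (hp0 n ζ))
  have hrow : ∀ ζ : levelSet V ok ξ.total,
      ENNReal.ofReal E * (ENNReal.ofReal (f ζ) * (Q.map (Y t)) {(ζ : Config V)})
        = ∑' n, ENNReal.ofReal ((t : ℝ) ^ n / n ! * (f ζ * p n ζ)) := by
    intro ζ
    have hs := (h.hasSum_law hY hξ hA hB t ζ.2).mul_left (f ζ)
    have hs' : HasSum (fun n => (t : ℝ) ^ n / n ! * (f ζ * p n ζ))
        (E * (f ζ * (Q.map (Y t)).real {(ζ : Config V)})) := by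
      have hval : E * (f ζ * (Q.map (Y t)).real {(ζ : Config V)})
          = f ζ * (Real.exp (Λ * t) * (Q.map (Y t)).real {(ζ : Config V)}) := by rw [hE]; ring
      rw [hval]
      refine hs.congr_fun fun n => ?_
      simp only [hp]
      ring
    rw [← ENNReal.ofReal_tsum_of_nonneg (fun n => hnn n ζ) hs'.summable, hs'.tsum_eq,
      ENNReal.ofReal_mul hE0.le, ENNReal.ofReal_mul (hf ζ ζ.2), ofReal_measureReal]
  have hcol : ∀ n, ∑' ζ : levelSet V ok ξ.total, ENNReal.ofReal ((t : ℝ) ^ n / n ! * (f ζ * p n ζ))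
      = ENNReal.ofReal ((t : ℝ) ^ n / n ! * (B.shiftedGenerator Λ)^[n] f ξ) := by
    intro n
    have hs := (hB.hasSum_iterate f n ξ hξ).mul_left ((t : ℝ) ^ n / n !)
    rw [← ENNReal.ofReal_tsum_of_nonneg (fun ζ => hnn n ζ) hs.summable, hs.tsum_eq]
  have hmul : ENNReal.ofReal E * ∑' ζ : levelSet V ok ξ.total,
      ENNReal.ofReal (f ζ) * (Q.map (Y t)) {(ζ : Config V)}
      = ENNReal.ofReal E * ENNReal.ofReal a := by
    rw [← ENNReal.tsum_mul_left, tsum_congr hrow, ENNReal.tsum_comm, tsum_congr hcol,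
      ← ENNReal.ofReal_tsum_of_nonneg _ ha.summable, ha.tsum_eq, ENNReal.ofReal_mul hE0.le]
    exact fun n => mul_nonneg (by positivity) (hB.iterate_nonneg hf n ξ hξ)
  exact (ENNReal.mul_right_inj (ENNReal.ofReal_pos.2 hE0).ne' ENNReal.ofReal_ne_top).1 hmul

/-- For f = 1 the series is that of exp(Λt), so the point masses on the level add up to 1. -/
theorem ae_mem_levelSet [Countable V] (h : DualityPair A B ok β) (hY : B.IsProcessFrom ξ Q 𝒢 Y)
    (hξ : ξ ∈ levelSet V ok ξ.total) (t : ℝ≥0) :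
    ∀ᵐ ω ∂Q, Y t ω ∈ levelSet V ok ξ.total := by
  have := hY.isProbabilityMeasure
  have := Measure.isProbabilityMeasure_map (μ := Q) (hY.measurable_apply t).aemeasurable
  obtain ⟨Λ, hA, hB⟩ := h.exists_isKernelOn_pair ξ.total
  have hcount := countable_levelSet (V := V) (ok := ok) ξ.total
  have hsum := h.tsum_law hY hξ hA hB t (f := fun _ => 1) (a := 1) (fun _ _ => zero_le_one) (by
    simp_rw [hB.iterate_one (fun x _ => B.shiftedGenerator_one Λ x) _ ξ hξ]
    have := NormedSpace.expSeries_div_hasSum_exp (𝔸 := ℝ) (Λ * t)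
    rw [← Real.exp_eq_exp_ℝ] at this
    rw [mul_one]
    refine this.congr_fun fun n => ?_
    rw [mul_pow]
    ring)
  rw [← lintegral_countable (fun _ => ENNReal.ofReal 1) hcount] at hsum
  simp only [ENNReal.ofReal_one, lintegral_const, one_mul, Measure.restrict_apply_univ] at hsum
  have hmem : ∀ᵐ x ∂(Q.map (Y t)), x ∈ levelSet V ok ξ.total :=
    (mem_ae_iff_prob_eq_one hcount.measurableSet).2 hsum
  exact ae_of_ae_map (hY.measurable_apply t).aemeasurable hmem

theorem expectation_eq [Countable V] (h : DualityPair A B ok β) (hY : B.IsProcessFrom ξ Q 𝒢 Y)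
    (hξ : ξ ∈ levelSet V ok ξ.total) {Λ : ℝ}
    (hA : IsKernelOn (Option (V × V)) (A.shiftedGenerator Λ) (levelSet V ok ξ.total))
    (hB : IsKernelOn (Option (V × V)) (B.shiftedGenerator Λ) (levelSet V ok ξ.total))
    (t : ℝ≥0) {f : Config V → ℝ} (hf : ∀ x, 0 ≤ f x) {a : ℝ} (ha0 : 0 ≤ a)
    (ha : HasSum (fun n => (t : ℝ) ^ n / n ! * (B.shiftedGenerator Λ)^[n] f ξ)
      (Real.exp (Λ * t) * a)) :
    Integrable (fun ω => f (Y t ω)) Q ∧ ∫ ω, f (Y t ω) ∂Q = a := by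
  have hsum := h.tsum_law hY hξ hA hB t (fun x _ => hf x) ha
  have hcount := countable_levelSet (V := V) (ok := ok) ξ.total
  set L := levelSet V ok ξ.total with hL
  -- Measurability of f is not assumed; its restriction to the countable level is measurable and
  -- agrees with it almost surely along the process.
  have hg : Measurable (L.indicator f) :=
    measurable_const.measurable_of_countable_ne (f := fun _ => (0 : ℝ))
      (hcount.mono fun x hx => by
        by_contra hxL
        exact hx (Set.indicator_of_notMem hxL f).symm)
  have hae : (fun ω => L.indicator f (Y t ω)) =ᵐ[Q] fun ω => f (Y t ω) :=
    (h.ae_mem_levelSet hY hξ t).mono fun ω hω => Set.indicator_of_mem hω f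
  have hmeas : AEStronglyMeasurable (fun ω => f (Y t ω)) Q :=
    (hg.comp (hY.measurable_apply t)).aestronglyMeasurable.congr hae
  have hlint : ∫⁻ ω, ENNReal.ofReal (f (Y t ω)) ∂Q = ENNReal.ofReal a := by
    rw [← hsum, ← lintegral_countable (fun x => ENNReal.ofReal (f x)) hcount,
      ← lintegral_indicator hcount.measurableSet,
      ← lintegral_congr_ae (hae.mono fun ω hω => congrArg ENNReal.ofReal hω),
      ← lintegral_map (f := fun x => ENNReal.ofReal (L.indicator f x)) hg.ennreal_ofReal
        (hY.measurable_apply t)]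
    refine lintegral_congr fun x => ?_
    by_cases hx : x ∈ L <;> simp [hx]
  refine ⟨⟨hmeas, ?_⟩, ?_⟩
  · rw [hasFiniteIntegral_iff_ofReal (Eventually.of_forall fun ω => hf _), hlint]
    exact ENNReal.ofReal_lt_top
  · rw [integral_eq_lintegral_of_nonneg_ae (Eventually.of_forall fun ω => hf _) hmeas, hlint,
      ENNReal.toReal_ofReal ha0]

end law

/-- Both expectations, multiplied by e^{Λt}, have the same exponential series: one by
`hasSum_dualMean`, the other by `expectation_eq` with f = D(·,η). -/
theorem isDual {V : Type u} [Countable V] {A B : ParticleSystem V} {ok : ℕ → Prop} {β : ℕ → ℝ}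
    (h : DualityPair A B ok β) : IsDual.{u, u₁, u₂} A B (fallingDual β) := by
  intro η _ ξ hξs hξ Ω _ P ℱ X hX Ω' _ Q 𝒢 Y hY t
  rw [h.space_right] at hξs
  have hmem : ξ ∈ levelSet V ok ξ.total := ⟨hξ, hξs, rfl⟩
  obtain ⟨Λ, hA, hB⟩ := h.exists_isKernelOn_pair ξ.total
  obtain ⟨hint, heq⟩ := h.expectation_eq hY hmem hA hB t
    (fun x => fallingDual_nonneg h.weight_pos x η)
    (integral_nonneg fun ω => fallingDual_nonneg h.weight_pos _ _)
    (h.hasSum_dualMean hX hB t.coe_nonneg hmem)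
  refine ⟨(h.ae_isFinite hY hξ t).mono fun ω hω => hω.1, h.integrable_fallingDual hX hξ t, hint, ?_⟩
  rw [heq]
  simp only [Real.toNNReal_coe]

end DualityPair

end

/-! ### The multi-layer models -/

namespace LayerRates

variable {d : ℕ} {S : Type*} (R : LayerRates d S)

theorem rtpRate_reverse (κ lam : ℝ) (vel : S → Fin d → ℤ) (v w : Site d S) :
    R.rtpRate κ lam (fun σ => -vel σ) v w = R.rtpRate κ lam vel w v := by
  obtain ⟨x, σ⟩ := v
  obtain ⟨y, σ'⟩ := w
  have h1 : R.π σ (y - x) = R.π σ (x - y) := by rw [← R.π_symm, neg_sub]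
  have h2 : y = x + -vel σ ↔ x = y + vel σ := by
    constructor <;> intro h <;> rw [h] <;> abel
  simp only [rtpRate]
  by_cases hσ : σ = σ'
  · subst hσ
    simp [h1, h2, eq_comm (a := x) (b := y)]
  · simp [hσ, Ne.symm hσ, eq_comm (a := x) (b := y), R.c_symm σ σ']

/-- Point reflection of w about the position of v turns jumps into v into jumps out of v with the
same displacement. This gives the balance of rates although the drift is not symmetric. -/
theorem rtpRate_reflect (κ lam : ℝ) (vel : S → Fin d → ℤ) (v w : Site d S) :
    R.rtpRate κ lam vel (v.1 + v.1 - w.1, w.2) v = R.rtpRate κ lam vel v w := by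
  obtain ⟨x, σ⟩ := v
  obtain ⟨y, σ'⟩ := w
  have h1 : x - (x + x - y) = y - x := by abel
  have h2 : x = x + x - y + vel σ ↔ y = x + vel σ := by
    constructor
    · intro h
      have : y = x + x - y + vel σ - x + y := by rw [← h]; abel
      rw [this]; abel
    · intro h; rw [h]; abel
  have h3 : x + x - y = x ↔ x = y := by
    constructor
    · intro h
      have : y = x + x - (x + x - y) := by abel
      rw [this, h]; abel
    · rintro rfl; abel
  simp only [rtpRate]
  by_cases hσ : σ = σ'
  · subst hσ
    simp [h1, h2, h3]
  · simp [hσ, Ne.symm hσ, h3, R.c_symm σ σ']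

theorem rtpRate_translate (κ lam : ℝ) (vel : S → Fin d → ℤ) (v w : Site d S) :
    R.rtpRate κ lam vel v (v.1 + w.1, w.2) = R.rtpRate κ lam vel (0, v.2) w := by
  classical
  have h1 : v.1 + w.1 = v.1 + vel v.2 ↔ w.1 = 0 + vel v.2 := by simp
  have h2 : v.1 = v.1 + w.1 ↔ 0 = w.1 := by simp [eq_comm]
  simp only [rtpRate, add_sub_cancel_left, sub_zero]
  exact congrArg₂ _ (congrArg₂ _ rfl (if_congr (and_congr_right' h1) rfl rfl))
    (if_congr h2 rfl rfl)

theorem rtpRate_nonneg {κ lam : ℝ} (hκ : 0 ≤ κ) (hlam : 0 ≤ lam) (vel : S → Fin d → ℤ)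
    (v w : Site d S) : 0 ≤ R.rtpRate κ lam vel v w := by
  have h1 := mul_nonneg hκ (R.π_nonneg v.2 (w.1 - v.1))
  have h2 := R.c_nonneg v.2 w.2
  unfold rtpRate
  split_ifs <;> positivity

theorem rtpRate_finite [Finite S] (κ lam : ℝ) (vel : S → Fin d → ℤ) (v : Site d S) :
    {w | R.rtpRate κ lam vel v w ≠ 0}.Finite := by
  have hN : (Set.Icc (-1 : Fin d → ℤ) 1 ∪ {vel v.2} ∪ {0}).Finite :=
    ((Set.finite_Icc _ _).union (Set.finite_singleton _)).union (Set.finite_singleton _)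
  refine ((hN.prod (Set.finite_univ (α := S))).image
    fun q : Site d S => ((v.1 + q.1, q.2) : Site d S)).subset fun w hw => ?_
  refine ⟨(w.1 - v.1, w.2), ⟨?_, Set.mem_univ _⟩, by simp⟩
  simp only [Set.mem_union, Set.mem_singleton_iff]
  by_contra! hcon
  obtain ⟨⟨h1, h2⟩, h3⟩ := hcon
  have e1 : R.π v.2 (w.1 - v.1) = 0 := by
    by_contra hne
    have hsum := R.π_nearest _ _ hne
    have habs : ∀ i, |(w.1 - v.1) i| ≤ 1 := fun i =>
      hsum ▸ Finset.single_le_sum (f := fun i => |(w.1 - v.1) i|) (fun _ _ => abs_nonneg _)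
        (Finset.mem_univ i)
    exact h1 ⟨fun i => (abs_le.1 (habs i)).1, fun i => (abs_le.1 (habs i)).2⟩
  have e2 : w.1 ≠ v.1 + vel v.2 := fun h => h2 (by rw [h]; abel)
  have e3 : v.1 ≠ w.1 := fun h => h3 (by rw [h]; abel)
  exact hw (by simp [rtpRate, e1, e2, e3])

theorem rtpRate_balance (κ lam : ℝ) (vel : S → Fin d → ℤ) (v : Site d S) :
    ∑ᶠ w, R.rtpRate κ lam vel v w = ∑ᶠ w, R.rtpRate κ lam vel w v := by
  rw [← finsum_comp_equiv (f := fun w => R.rtpRate κ lam vel w v)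
    ((Equiv.subLeft (v.1 + v.1)).prodCongr (Equiv.refl S))]
  exact finsum_congr fun w => (R.rtpRate_reflect κ lam vel v w).symm

/-- By translation invariance the total rate depends only on the layer, and there are finitely many
layers. -/
theorem rtpRate_sum_le [Finite S] (κ lam : ℝ) (vel : S → Fin d → ℤ) :
    ∃ M, ∀ v, ∑ᶠ w, R.rtpRate κ lam vel v w ≤ M := by
  obtain ⟨M, hM⟩ := Finite.exists_le fun σ : S => ∑ᶠ w, R.rtpRate κ lam vel (0, σ) w
  refine ⟨M, fun v => le_trans (le_of_eq ?_) (hM v.2)⟩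
  rw [← finsum_comp_equiv (f := fun w => R.rtpRate κ lam vel v w)
    ((Equiv.addLeft v.1).prodCongr (Equiv.refl S))]
  exact finsum_congr fun w => R.rtpRate_translate κ lam vel v w

theorem symmetricRate_eq : R.symmetricRate = R.rtpRate 1 0 fun _ => 0 := by
  ext v w
  simp [symmetricRate, rtpRate]

theorem symmetricRate_symm (v w : Site d S) : R.symmetricRate v w = R.symmetricRate w v := by
  rw [symmetricRate_eq, ← rtpRate_reverse]
  simp

theorem rtpRate_finite_range [Finite S] (κ lam : ℝ) (vel : S → Fin d → ℤ) (v : Site d S) :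
    {w | R.rtpRate κ lam vel v w ≠ 0 ∨ R.rtpRate κ lam vel w v ≠ 0}.Finite := by
  refine ((R.rtpRate_finite κ lam vel v).union
    (R.rtpRate_finite κ lam (fun σ => -vel σ) v)).subset fun w hw => ?_
  simp only [Set.mem_union, Set.mem_ofPred_eq, rtpRate_reverse]
  exact hw

theorem dualityPair_rtp [Finite S] {κ lam : ℝ} (vel : S → Fin d → ℤ) {α : ℝ} (hκ : 0 ≤ κ)
    (hlam : 0 ≤ lam) (hα : 0 < α) :
    DualityPair (R.rtp κ lam vel α) (R.rtp κ lam (fun σ => -vel σ) α) (fun _ => True)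
      fun _ => 1 where
  rate_swap := R.rtpRate_reverse κ lam vel
  α_eq := rfl
  s_eq := rfl
  space_left := by simp [rtp]
  space_right := by simp [rtp]
  rate_nonneg := R.rtpRate_nonneg hκ hlam vel
  finite_range := R.rtpRate_finite_range κ lam vel
  balance := R.rtpRate_balance κ lam vel
  rate_le := R.rtpRate_sum_le κ lam vel
  symm_of_ne := Or.inl rfl
  ok_of_le _ _ := trivial
  factor_nonneg _ := by simp [rtp, hα.le]
  factor_eq_zero _ h := absurd trivial h
  weight_zero := rfl
  weight_pos _ := one_pos
  -- For s = 0 the factor is the constant α, so unit weights satisfy the recursion with γ = α;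
  -- exclusion and inclusion use γ = 1.
  weight_succ := ⟨α, fun k _ => by simp [rtp]⟩

/-- The assumptions on the rates in `DualityPair` hold for the symmetric multi-layer rates. -/
theorem dualityPair_symmetric [Finite S] {A : ParticleSystem (Site d S)} {ok : ℕ → Prop}
    {β : ℕ → ℝ} (hrate : A.rate = R.symmetricRate) (hspace : A.space = {η | ∀ v, ok (η v)})
    (hok : ∀ {m n}, ok n → m ≤ n → ok m) (hnn : ∀ {n : ℕ}, ok n → 0 ≤ A.α + A.s * n)
    (hzero : ∀ {n : ℕ}, ok n → ¬ ok (n + 1) → A.α + A.s * n = 0) (h0 : β 0 = 1)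
    (hpos : ∀ k, 0 < β k) (hsucc : ∀ k : ℕ, ok (k + 1) → β k = β (k + 1) * (A.α + A.s * k)) :
    DualityPair A A ok β where
  rate_swap v w := by rw [hrate, symmetricRate_symm]
  α_eq := rfl
  s_eq := rfl
  space_left := hspace
  space_right := hspace
  rate_nonneg := by
    rw [hrate, symmetricRate_eq]; exact R.rtpRate_nonneg zero_le_one le_rfl _
  finite_range := by rw [hrate, symmetricRate_eq]; exact R.rtpRate_finite_range _ _ _
  balance := by rw [hrate, symmetricRate_eq]; exact R.rtpRate_balance _ _ _
  rate_le := by rw [hrate, symmetricRate_eq]; exact R.rtpRate_sum_le _ _ _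
  symm_of_ne := Or.inr fun v w => by rw [hrate, symmetricRate_symm]
  ok_of_le := hok
  factor_nonneg := hnn
  factor_eq_zero := hzero
  weight_zero := h0
  weight_pos := hpos
  weight_succ := ⟨1, fun k hk => by rw [one_mul, hsucc k hk]⟩

theorem dualityPair_sep [Finite S] (α : ℕ) :
    DualityPair (R.sep α) (R.sep α) (fun n => n ≤ α)
      fun k => ((α - k)! : ℝ) / (α ! : ℝ) := by
  refine R.dualityPair_symmetric rfl rfl (fun h h' => h'.trans h) (fun {n} h => ?_)
    (fun {n} h h' => ?_) ?_ (fun k => by positivity) fun k hk => ?_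
  · have : (n : ℝ) ≤ α := by exact_mod_cast h
    simp only [sep]; linarith
  · have : n = α := by omega
    simp [sep, this]
  · have : (α ! : ℝ) ≠ 0 := by positivity
    simp [this]
  -- Here k + 1 ≤ α, so the truncated subtractions in the weights are genuine.
  · have h1 : α - k = (α - (k + 1)) + 1 := by omega
    have h2 : ((α - (k + 1) : ℕ) : ℝ) = α - (k + 1) := by push_cast [Nat.cast_sub hk]; ring
    rw [h1, Nat.factorial_succ]
    push_cast
    rw [h2]
    simp only [sep]
    ring

theorem dualityPair_sip [Finite S] {α : ℝ} (hα : 0 < α) :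
    DualityPair (R.sip α) (R.sip α) (fun _ => True)
      fun k => Real.Gamma α / Real.Gamma (α + k) := by
  have hΓ : ∀ k : ℕ, 0 < Real.Gamma (α + k) := fun k => Real.Gamma_pos_of_pos (by positivity)
  refine R.dualityPair_symmetric rfl (by simp [sip]) (fun _ _ => trivial) (fun {n} _ => ?_)
    (fun _ h => absurd trivial h) ?_ (fun k => div_pos (Real.Gamma_pos_of_pos hα) (hΓ k))
    fun k _ => ?_
  · simp only [sip]; positivity
  · have := (hΓ 0).ne'
    simp only [Nat.cast_zero, add_zero] at this ⊢
    exact div_self this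
  · have h1 : Real.Gamma (α + (k + 1 : ℕ)) = (α + k) * Real.Gamma (α + k) := by
      rw [← Real.Gamma_add_one (by positivity)]; push_cast; ring_nf
    have h2 := (hΓ k).ne'
    have h3 : α + k ≠ 0 := by positivity
    rw [h1]
    simp only [sip]
    field_simp

end LayerRates

theorem factorized_eq_fallingDual {V : Type*} {δ : ℕ → ℕ → ℝ} {β : ℕ → ℝ}
    (h : ∀ k n, δ k n = if k ≤ n then (n ! : ℝ) / ((n - k)! : ℝ) * β k else 0) :
    (factorized δ : Config V → Config V → ℝ) = fallingDual β := by
  ext ξ η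
  refine finprod_congr fun v => ?_
  rw [h]
  split_ifs with hle
  · have h1 : ((η v - ξ v)! : ℝ) ≠ 0 := by positivity
    have h2 : ((η v)! : ℝ) = ((η v - ξ v)! : ℝ) * (η v).descFactorial (ξ v) := by
      exact_mod_cast (Nat.factorial_mul_descFactorial hle).symm
    rw [h2]
    field_simp
  · simp [Nat.descFactorial_eq_zero_iff_lt.2 (not_le.1 hle)]

end
theorem mainTheorem4 (d : ℕ) (S : Type u) [Finite S] (R : LayerRates d S) :
    (∀ α : ℕ,
      IsDual.{u, u₁, u₂} (R.sep α) (R.sep α) (factorized (dSEP α))) ∧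
    (∀ α : ℝ, 0 < α →
      IsDual.{u, u₁, u₂} (R.sip α) (R.sip α) (factorized (dSIP α))) ∧
    (∀ (κ lam : ℝ) (vel : S → Fin d → ℤ) (α : ℝ), 0 ≤ κ → 0 ≤ lam → 0 < α →
      IsDual.{u, u₁, u₂} (R.rtp κ lam vel α) (R.rtp κ lam (fun σ => -vel σ) α)
        (factorized dRTP)) := by
  refine ⟨fun α => ?_, fun α hα => ?_, fun κ lam vel α hκ hlam hα => ?_⟩
  · rw [factorized_eq_fallingDual (δ := dSEP α) (β := fun k => ((α - k)! : ℝ) / (α ! : ℝ)) fun _ _ => rfl]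
    exact (R.dualityPair_sep α).isDual
  · rw [factorized_eq_fallingDual (δ := dSIP α) (β := fun k => Real.Gamma α / Real.Gamma (α + k)) fun _ _ => rfl]
    exact (R.dualityPair_sip hα).isDual
  · rw [factorized_eq_fallingDual (δ := dRTP) (β := fun _ => 1) fun k n => by simp [dRTP]]
    exact (R.dualityPair_rtp vel hκ hlam hα).isDual
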